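/- **Setting.** A free algebra $\mathbb{A}$ is a finite set $\mathcal{C}_{\mathbb{A}}=\{c_1^{\mathbb A},\dots,c_{k(\mathbb A)}^{\mathbb A}\}$ of constructors with an arity $\mathcal{R}(c)\in\mathbb{N}$ for each constructor $c$. Fix a finite family $\mathscr{A}$ of free algebras with pairwise disjoint constructor sets that contains the algebras $\mathbb{U}$ (arities $1,0$), $\mathbb{B}$ (arities $1,1,0$), $\mathbb{C}$ (arities $2,0$) and $\mathbb{D}$ (arities $2,2,0$). A binary string $s$ is encoded by a term $\ulcorner s\urcorner$ of $\mathbb{B}$: $\ulcorner\varepsilon\urcorner=c_3^{\mathbb B}$, $\ulcorner 0s\urcorner=c_1^{\mathbb B}\ulcorner s\urcorner$, $\ulcorner 1s\urcorner=c_2^{\mathbb B}\ulcorner s\urcorner$. *Terms* (up to renaming of bound variables) are $M::=x\mid c\mid MM\mid\lambda x.M\mid M\{\!\{M,\dots,M\}\!\}\mid M\langle\!\langle M,\dots,M\rangle\!\rangle$ with $c$ a constructor (the last two are conditional and recursion). *Values* are variables, abstractions, and terms built from constructors by application. Reduction $\leadsto$ is the closure of the following rules under $ML\leadsto NL$, $LM\leadsto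 LN$, $M\{\!\{\vec L\}\!\}\leadsto N\{\!\{\vec L\}\!\}$ and $M\langle\!\langle\vec L\rangle\!\rangle\leadsto N\langle\!\langle\vec L\rangle\!\rangle$ whenever $M\leadsto N$ (so not under abstractions or inside branches): $(\lambda x.M)V\leadsto M\{V/x\}$ for a value $V$, and, for $c_i\in\mathcal{C}_{\mathbb A}$ of arity $r$, for terms $t_1,\dots,t_r$ of the free algebra $\mathbb{A}$, and for $\vec M=M_1,\dots,M_{k(\mathbb A)}$, $$(c_i t_1\cdots t_r)\{\!\{\vec M\}\!\}\leadsto M_i t_1\cdots t_r,\qquad (c_i t_1\cdots t_r)\langle\!\langle\vec M\rangle\!\rangle\leadsto M_i t_1\cdots t_r\,(t_1\langle\!\langle\vec M\rangle\!\rangle)\cdots(t_r\langle\!\langle\vec M\rangle\!\rangle).$$ *Types* are $A::=\mathbb{A}^n\mid A\multimap A$ ($\mathbb{A}\in\mathscr{A}$, $n\in\mathbb{N}$), with level $V(\mathbb{A}^n)=n$, $V(A\multimap B)=\max\{V(A),V(B)\}$; $A\multimap^{k}B$ is $A\multimap\cdots\multimap A\multimap B$ with $k$ copies of $A$. For a class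 $\mathsf{D}$ of types, $\Gamma\vdash_{\mathsf{RH}(\mathsf{D})}M:A$ is generated by the following rules, where contexts separated by a comma have disjoint domains: - $x:A\vdash x:A$; - weakening: from $\Gamma\vdash M:B$ infer $\Gamma,x:A\vdash M:B$; - contraction, only if $A\in\mathsf{D}$: from $\Gamma,x:A,y:A\vdash M:B$ infer $\Gamma,z:A\vdash M\{z/x,z/y\}:B$; - from $\Gamma,x:A\vdash M:B$ infer $\Gamma\vdash\lambda x.M:A\multimap B$; - from $\Gamma\vdash M:A\multimap B$ and $\Delta\vdash N:A$ infer $\Gamma,\Delta\vdash MN:B$; - $\vdash c:\mathbb{A}^n\multimap^{\mathcal{R}(c)}\mathbb{A}^n$ for $c\in\mathcal{C}_{\mathbb A}$ and $n\in\mathbb{N}$; - conditional: from $\Gamma_i\vdash M_i:\mathbb{A}^m\multimap^{\mathcal{R}(c_i^{\mathbb A})}C$ for $i=1,\dots,k(\mathbb{A})$ and $\Delta\vdash L:\mathbb{A}^m$ infer $\Gamma_1,\dots,\Gamma_{k(\mathbb A)},\Delta\vdash L\{\!\{M_1,\dots,M_{k(\mathbb A)}\}\!\}:C$; - recursion, only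 if $m>V(C)$ and all types in $\Gamma_1,\dots,\Gamma_{k(\mathbb A)}$ are in $\mathsf{D}$: from $\Gamma_i\vdash M_i:\mathbb{A}^m\multimap^{\mathcal{R}(c_i^{\mathbb A})}C\multimap^{\mathcal{R}(c_i^{\mathbb A})}C$ for $i=1,\dots,k(\mathbb{A})$ and $\Delta\vdash L:\mathbb{A}^m$ infer $\Gamma_1,\dots,\Gamma_{k(\mathbb A)},\Delta\vdash L\langle\!\langle M_1,\dots,M_{k(\mathbb A)}\rangle\!\rangle:C$. Let $\mathsf{A}=\{\mathbb{A}^n\mid\mathbb{A}\in\mathscr{A},\,n\in\mathbb{N}\}$ be the class of all base types. A term $M$ *represents* $f:\{0,1\}^*\to\{0,1\}^*$ if $M\ulcorner s\urcorner\leadsto^*\ulcorner f(s)\urcorner$ for every $s\in\{0,1\}^*$. A function is computable in polynomial (elementary) time if some Turing machine computes it in a number of steps bounded by a polynomial (by a Kalmár elementary function) of the length of the input. **Theorem.** (1) For every polynomial time computable function $f:\{0,1\}^*\to\{0,1\}^*$ there are a term $M_f$ and an integer $n_f\ge 0$ such that $\vdash_{\mathsf{RH}(\emptyset)}M_f:\mathbb{B}^{n_f}\multimap\mathbb{B}^0$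 and $M_f$ represents $f$. (2) For every elementary time computable function $f:\{0,1\}^*\to\{0,1\}^*$ there are a term $M_f$ and an integer $n_f\ge 0$ such that $\vdash_{\mathsf{RH}(\mathsf{A})}M_f:\mathbb{B}^{n_f}\multimap\mathbb{B}^0$ and $M_f$ represents $f$. -/

import Mathlib

namespace LinRec

/-! ### Free algebras and the fixed family of free algebras -/

/-- A free algebra: finitely many constructors `0, …, numCon - 1`, each with an arity. -/
structure FreeAlgebra where
  numCon : ℕ
  arity : Fin numCon → ℕ

/-- A finite family of free algebras that contains the algebras `U` (unary strings), `B` (binary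
strings), `C` (binary trees) and `D` (binary trees with binary labels); the other members are
given by `extra`. -/
structure Family where
  numExtra : ℕ
  extra : Fin numExtra → FreeAlgebra

/-- Names for the members of a family. -/
inductive Idx (𝒜 : Family) : Type
  | U
  | B
  | C
  | D
  | other (j : Fin 𝒜.numExtra)

/-- The free algebra with a given name. -/
def Idx.alg {𝒜 : Family} : Idx 𝒜 → FreeAlgebra
  | .U => ⟨2, ![1, 0]⟩
  | .B => ⟨3, ![1, 1, 0]⟩
  | .C => ⟨2, ![2, 0]⟩
  | .D => ⟨3, ![2, 2, 0]⟩
  | .other j => 𝒜.extra j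

/-! ### Terms -/

/-- Terms, in de Bruijn notation, so that they are identified up to renaming of bound variables.
A constructor is a pair of (the name of) an algebra and a constructor of that algebra, so that
constructor sets of different algebras are disjoint.
`cond L k M` is the conditional `L {{M 0, …, M (k-1)}}` and `recur L k M` is the
recursion `L ⟨⟨M 0, …, M (k-1)⟩⟩`. -/
inductive Tm (𝒜 : Family) : Type
  | var (x : ℕ)
  | con (a : Idx 𝒜) (c : Fin a.alg.numCon)
  | app (M N : Tm 𝒜)
  | lam (M : Tm 𝒜)
  | cond (L : Tm 𝒜) (k : ℕ) (M : Fin k → Tm 𝒜)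
  | recur (L : Tm 𝒜) (k : ℕ) (M : Fin k → Tm 𝒜)

namespace Tm

variable {𝒜 : Family}

/-- Renaming of free variables. -/
def rename (ρ : ℕ → ℕ) : Tm 𝒜 → Tm 𝒜
  | var x => var (ρ x)
  | con a c => con a c
  | app M N => app (M.rename ρ) (N.rename ρ)
  | lam M => lam (M.rename (fun x => Nat.casesOn x 0 (fun y => ρ y + 1)))
  | cond L k M => cond (L.rename ρ) k (fun i => (M i).rename ρ)
  | recur L k M => recur (L.rename ρ) k (fun i => (M i).rename ρ)

/-- Simultaneous capture-avoiding substitution. -/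
def subst (σ : ℕ → Tm 𝒜) : Tm 𝒜 → Tm 𝒜
  | var x => σ x
  | con a c => con a c
  | app M N => app (M.subst σ) (N.subst σ)
  | lam M => lam (M.subst (fun x => Nat.casesOn x (var 0) (fun y => (σ y).rename Nat.succ)))
  | cond L k M => cond (L.subst σ) k (fun i => (M i).subst σ)
  | recur L k M => recur (L.subst σ) k (fun i => (M i).subst σ)

/-- `M{V/x}`, where `x` is the outermost free variable `0` of `M`. -/
def inst (M V : Tm 𝒜) : Tm 𝒜 :=
  M.subst (fun x => Nat.casesOn x V var)

/-- `M N₁ ⋯ Nₖ`. -/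
def apps (M : Tm 𝒜) (Ns : List (Tm 𝒜)) : Tm 𝒜 := Ns.foldl app M

/-- The terms built from constructors by application only. -/
inductive IsAlgebraic : Tm 𝒜 → Prop
  | con (a : Idx 𝒜) (c : Fin a.alg.numCon) : IsAlgebraic (con a c)
  | app {M N : Tm 𝒜} : IsAlgebraic M → IsAlgebraic N → IsAlgebraic (app M N)

/-- Values. -/
inductive IsValue : Tm 𝒜 → Prop
  | var (x : ℕ) : IsValue (var x)
  | lam (M : Tm 𝒜) : IsValue (lam M)
  | alg {M : Tm 𝒜} : IsAlgebraic M → IsValue M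

/-- `t` is a term of the free algebra `a`, i.e. `c t₁ ⋯ tₖ` with `c` a constructor of `a` of
arity `k` and `t₁, …, tₖ` terms of the free algebra `a`. -/
inductive IsFree (a : Idx 𝒜) : Tm 𝒜 → Prop
  | mk (c : Fin a.alg.numCon) (t : Fin (a.alg.arity c) → Tm 𝒜) (ht : ∀ j, IsFree a (t j)) :
      IsFree a ((con a c).apps (List.ofFn t))

/-! ### Weak call-by-value reduction -/

/-- The redexes and their contracta. -/
inductive Contract : Tm 𝒜 → Tm 𝒜 → Prop
  | beta (M V : Tm 𝒜) (hV : IsValue V) : Contract (app (lam M) V) (M.inst V)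
  | cond (a : Idx 𝒜) (c : Fin a.alg.numCon) (t : Fin (a.alg.arity c) → Tm 𝒜)
      (ht : ∀ j, IsFree a (t j)) (M : Fin a.alg.numCon → Tm 𝒜) :
      Contract (cond ((con a c).apps (List.ofFn t)) a.alg.numCon M)
        ((M c).apps (List.ofFn t))
  | recur (a : Idx 𝒜) (c : Fin a.alg.numCon) (t : Fin (a.alg.arity c) → Tm 𝒜)
      (ht : ∀ j, IsFree a (t j)) (M : Fin a.alg.numCon → Tm 𝒜) :
      Contract (recur ((con a c).apps (List.ofFn t)) a.alg.numCon M)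
        (((M c).apps (List.ofFn t)).apps
          (List.ofFn (fun j => recur (t j) a.alg.numCon M)))

/-- One-step reduction: no redex is fired under an abstraction or inside the branches of a
conditional or of a recursion. -/
inductive Step : Tm 𝒜 → Tm 𝒜 → Prop
  | contract {M N : Tm 𝒜} : Contract M N → Step M N
  | appL {M N : Tm 𝒜} (L : Tm 𝒜) : Step M N → Step (app M L) (app N L)
  | appR (L : Tm 𝒜) {M N : Tm 𝒜} : Step M N → Step (app L M) (app L N)
  | cond {M N : Tm 𝒜} (k : ℕ) (L : Fin k → Tm 𝒜) : Step M N → Step (cond M k L) (cond N k L)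
  | recur {M N : Tm 𝒜} (k : ℕ) (L : Fin k → Tm 𝒜) : Step M N → Step (recur M k L) (recur N k L)

/-- Many-step reduction. -/
def Steps : Tm 𝒜 → Tm 𝒜 → Prop := Relation.ReflTransGen Step

/-- The term of the algebra `B` that encodes a binary string. -/
def ofString : List Bool → Tm 𝒜
  | [] => con .B (2 : Fin 3)
  | false :: s => app (con .B (0 : Fin 3)) (ofString s)
  | true :: s => app (con .B (1 : Fin 3)) (ofString s)

/-- `M` represents the function `f` on binary strings. -/
def Represents (M : Tm 𝒜) (f : List Bool → List Bool) : Prop :=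
  ∀ s : List Bool, Steps (app M (ofString s)) (ofString (f s))

end Tm

/-! ### Types and type assignment -/

/-- Types: `base a n` is the base type of the algebra `a` with index (tier) `n`,
and `arrow A B` is the linear arrow from `A` to `B`. -/
inductive Ty (𝒜 : Family) : Type
  | base (a : Idx 𝒜) (n : ℕ)
  | arrow (A B : Ty 𝒜)

namespace Ty

variable {𝒜 : Family}

/-- The level of a type. -/
def level : Ty 𝒜 → ℕ
  | base _ n => n
  | arrow A B => max A.level B.level

/-- `A ⊸ ⋯ ⊸ A ⊸ B`, with `n` copies of `A`. -/
def arrows (A : Ty 𝒜) : ℕ → Ty 𝒜 → Ty 𝒜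
  | 0, B => B
  | n + 1, B => arrow A (arrows A n B)

/-- The class of all base types. -/
def baseTypes (𝒜 : Family) : Set (Ty 𝒜) := {A | ∃ a n, A = base a n}

end Ty

/-- Typing contexts: partial maps from variables to types. -/
def Ctx (𝒜 : Family) : Type := ℕ → Option (Ty 𝒜)

namespace Ctx

variable {𝒜 : Family}

/-- The empty context. -/
def empty : Ctx 𝒜 := fun _ => none

/-- The context `Γ, x : A` (used only when `x` is not declared in `Γ`). -/
def extend (Γ : Ctx 𝒜) (x : ℕ) (A : Ty 𝒜) : Ctx 𝒜 := fun y => if y = x then some A else Γ y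

/-- The context `Γ, x : A` for the body of an abstraction, with the bound variable as variable `0`
and the variables of `Γ` shifted by one. -/
def bind (A : Ty 𝒜) (Γ : Ctx 𝒜) : Ctx 𝒜 := fun x => Nat.casesOn x (some A) Γ

/-- `Γ` is the union of the contexts `Δ k`, and these have pairwise disjoint domains. -/
def IsDisjointUnion {κ : Type} (Δ : κ → Ctx 𝒜) (Γ : Ctx 𝒜) : Prop :=
  (∀ x k l, Δ k x ≠ none → Δ l x ≠ none → k = l) ∧
    ∀ x A, Γ x = some A ↔ ∃ k, Δ k x = some A

end Ctx

/-- `RH 𝒟 Γ M A` is the judgement `Γ ⊢ M : A` of the ramified system in which contraction, and the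
contexts of the branches of a recursion, are limited to types in the class `𝒟`. In the rules for
conditional and recursion, `Γs i` is the context of the `i`-th branch and `Δ` the context of the
principal argument. -/
inductive RH {𝒜 : Family} (𝒟 : Set (Ty 𝒜)) : Ctx 𝒜 → Tm 𝒜 → Ty 𝒜 → Prop
  | ax (x : ℕ) (A : Ty 𝒜) : RH 𝒟 (Ctx.empty.extend x A) (.var x) A
  | weak {Γ : Ctx 𝒜} {M : Tm 𝒜} {B : Ty 𝒜} (x : ℕ) (A : Ty 𝒜) (hx : Γ x = none) :
      RH 𝒟 Γ M B → RH 𝒟 (Γ.extend x A) M B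
  | contr {Γ : Ctx 𝒜} {M : Tm 𝒜} {B : Ty 𝒜} (x y z : ℕ) (A : Ty 𝒜) (hA : A ∈ 𝒟)
      (hxy : x ≠ y) (hx : Γ x = none) (hy : Γ y = none) (hz : Γ z = none) :
      RH 𝒟 ((Γ.extend x A).extend y A) M B →
      RH 𝒟 (Γ.extend z A) (M.rename (fun v => if v = x ∨ v = y then z else v)) B
  | lam {Γ : Ctx 𝒜} {M : Tm 𝒜} {A B : Ty 𝒜} :
      RH 𝒟 (Ctx.bind A Γ) M B → RH 𝒟 Γ (.lam M) (.arrow A B)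
  | app {Γ Δ Θ : Ctx 𝒜} {M N : Tm 𝒜} {A B : Ty 𝒜} (hΘ : Ctx.IsDisjointUnion ![Γ, Δ] Θ) :
      RH 𝒟 Γ M (.arrow A B) → RH 𝒟 Δ N A → RH 𝒟 Θ (.app M N) B
  | con (a : Idx 𝒜) (c : Fin a.alg.numCon) (n : ℕ) :
      RH 𝒟 Ctx.empty (.con a c) (Ty.arrows (.base a n) (a.alg.arity c) (.base a n))
  | cond (a : Idx 𝒜) (m : ℕ) {C : Ty 𝒜} {Γs : Fin a.alg.numCon → Ctx 𝒜} {Δ Θ : Ctx 𝒜}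
      {L : Tm 𝒜} {M : Fin a.alg.numCon → Tm 𝒜}
      (hΘ : Ctx.IsDisjointUnion (fun o : Option (Fin a.alg.numCon) => o.elim Δ Γs) Θ) :
      (∀ i, RH 𝒟 (Γs i) (M i) (Ty.arrows (.base a m) (a.alg.arity i) C)) →
      RH 𝒟 Δ L (.base a m) →
      RH 𝒟 Θ (.cond L a.alg.numCon M) C
  | recur (a : Idx 𝒜) (m : ℕ) {C : Ty 𝒜} {Γs : Fin a.alg.numCon → Ctx 𝒜} {Δ Θ : Ctx 𝒜}
      {L : Tm 𝒜} {M : Fin a.alg.numCon → Tm 𝒜}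
      (hΘ : Ctx.IsDisjointUnion (fun o : Option (Fin a.alg.numCon) => o.elim Δ Γs) Θ)
      (hΓs : ∀ i x A, Γs i x = some A → A ∈ 𝒟)
      (hm : C.level < m) :
      (∀ i, RH 𝒟 (Γs i) (M i)
        (Ty.arrows (.base a m) (a.alg.arity i) (Ty.arrows C (a.alg.arity i) C))) →
      RH 𝒟 Δ L (.base a m) →
      RH 𝒟 Θ (.recur L a.alg.numCon M) C

/-! ### Complexity classes -/

/-- The (Kalmár) elementary functions `ℕⁿ → ℕ`. -/
inductive Elementary : {n : ℕ} → ((Fin n → ℕ) → ℕ) → Prop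
  | zero {n : ℕ} : Elementary (fun _ : Fin n → ℕ => 0)
  | succ : Elementary (fun v : Fin 1 → ℕ => v 0 + 1)
  | proj {n : ℕ} (i : Fin n) : Elementary (fun v : Fin n → ℕ => v i)
  | add : Elementary (fun v : Fin 2 → ℕ => v 0 + v 1)
  | tsub : Elementary (fun v : Fin 2 → ℕ => v 0 - v 1)
  | comp {m n : ℕ} {f : (Fin m → ℕ) → ℕ} {g : Fin m → (Fin n → ℕ) → ℕ} :
      Elementary f → (∀ i, Elementary (g i)) → Elementary (fun v => f (fun i => g i v))
  | bsum {n : ℕ} {f : (Fin (n + 1) → ℕ) → ℕ} : Elementary f →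
      Elementary (fun v : Fin (n + 1) → ℕ =>
        ∑ i ∈ Finset.range (v 0), f (Fin.cons i (Fin.tail v)))
  | bprod {n : ℕ} {f : (Fin (n + 1) → ℕ) → ℕ} : Elementary f →
      Elementary (fun v : Fin (n + 1) → ℕ =>
        ∏ i ∈ Finset.range (v 0), f (Fin.cons i (Fin.tail v)))

/-- `f` is computed by a Turing machine whose running time is bounded by a polynomial in the
length of the input. -/
def PolyTimeComputable (f : List Bool → List Bool) : Prop :=
  Nonempty (Turing.TM2ComputableInPolyTime (id : List Bool → List Bool) id f)

/-- `f` is computed by a Turing machine whose running time is bounded by an elementary function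
of the length of the input. -/
def ElementaryTimeComputable (f : List Bool → List Bool) : Prop :=
  ∃ h : Turing.TM2ComputableInTime (id : List Bool → List Bool) id f,
    Elementary (fun v : Fin 1 → ℕ => h.time (v 0))

end LinRec

/-!
Every type is interpreted by functions on strings and trees, and a logical relation says when a
term realizes such a function, so that it suffices to exhibit linear combinators that denote the
functions wanted.

A configuration of a stack machine is coded as a binary tree. For a fixed statement of the machine,
its effect on the code is a composition of permutations of the stacks, pushes and pops, each of
which uses its argument once. Distinctions between finitely many symbols or states are made by
conditionals, which a label at the root of the tree drives. Hence a single step is a linear function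
on trees, and the run of the machine is its iteration, clocked by a copy of the input.

Linearity gives no second copy of the input, but recursion over a string of the next tier builds two
copies in parallel. If iteration for `N n` rounds is definable, then so is iteration for
`N 0 + ⋯ + N n` rounds; starting from `1` this yields the binomial coefficients `(n + k).choose k`,
which dominate every polynomial up to a constant factor. If contraction of tree types is available,
then `t ↦ node t t` is definable, whose iteration from a leaf builds the complete binary tree of
height `n`. Recursion over that tree gives `2 ^ n` rounds, and repetition gives towers of
exponentials, which dominate every elementary function.
-/

namespace LinRec

variable {𝒜 : Family}

local notation:60 A:61 " ⊸ " B:60 => Ty.arrow A B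

namespace Tm

/-! ### Substitution and reduction -/

/-- The substitution that maps variable `0` to `V` and variable `x + 1` to `σ x`. -/
def scons (V : Tm 𝒜) (σ : ℕ → Tm 𝒜) : ℕ → Tm 𝒜 := fun x => Nat.casesOn x V σ

theorem rename_eq_subst (M : Tm 𝒜) (ρ : ℕ → ℕ) : M.rename ρ = M.subst (fun x => var (ρ x)) := by
  induction M generalizing ρ with
  | var | con => rfl
  | app M N ihM ihN => simp only [rename, subst, ihM, ihN]
  | lam M ih =>
    simp only [rename, subst, ih]
    congr 2
    funext x
    cases x <;> rfl
  | cond L k M ihL ihM => simp only [rename, subst, ihL, ihM]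
  | recur L k M ihL ihM => simp only [rename, subst, ihL, ihM]

theorem subst_rename (M : Tm 𝒜) (ρ : ℕ → ℕ) (σ : ℕ → Tm 𝒜) :
    (M.rename ρ).subst σ = M.subst (fun x => σ (ρ x)) := by
  induction M generalizing ρ σ with
  | var | con => rfl
  | app M N ihM ihN => simp only [rename, subst, ihM, ihN]
  | lam M ih =>
    simp only [rename, subst, ih]
    congr 2
    funext x
    cases x <;> rfl
  | cond L k M ihL ihM => simp only [rename, subst, ihL, ihM]
  | recur L k M ihL ihM => simp only [rename, subst, ihL, ihM]

theorem rename_rename (M : Tm 𝒜) (ρ ρ' : ℕ → ℕ) :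
    (M.rename ρ).rename ρ' = M.rename (fun x => ρ' (ρ x)) := by
  rw [rename_eq_subst _ ρ', subst_rename, rename_eq_subst]

theorem rename_subst (M : Tm 𝒜) (σ : ℕ → Tm 𝒜) (ρ : ℕ → ℕ) :
    (M.subst σ).rename ρ = M.subst (fun x => (σ x).rename ρ) := by
  induction M generalizing σ ρ with
  | var | con => rfl
  | app M N ihM ihN => simp only [rename, subst, ihM, ihN]
  | lam M ih =>
    simp only [rename, subst, ih]
    congr 2
    funext x
    cases x
    · rfl
    · simp only [rename_rename]
  | cond L k M ihL ihM => simp only [rename, subst, ihL, ihM]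
  | recur L k M ihL ihM => simp only [rename, subst, ihL, ihM]

theorem subst_subst (M : Tm 𝒜) (σ τ : ℕ → Tm 𝒜) :
    (M.subst σ).subst τ = M.subst (fun x => (σ x).subst τ) := by
  induction M generalizing σ τ with
  | var | con => rfl
  | app M N ihM ihN => simp only [subst, ihM, ihN]
  | lam M ih =>
    simp only [subst, ih]
    congr 2
    funext x
    cases x
    · rfl
    · simp only [subst_rename, rename_subst]
  | cond L k M ihL ihM => simp only [subst, ihL, ihM]
  | recur L k M ihL ihM => simp only [subst, ihL, ihM]

theorem subst_var (M : Tm 𝒜) : M.subst var = M := by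
  induction M with
  | var | con => rfl
  | app M N ihM ihN => simp only [subst, ihM, ihN]
  | lam M ih =>
    rw [subst]
    convert congrArg lam ih using 3
    funext x
    cases x <;> rfl
  | cond L k M ihL ihM => simp only [subst, ihL, ihM]
  | recur L k M ihL ihM => simp only [subst, ihL, ihM]

theorem subst_inst (M V : Tm 𝒜) (σ : ℕ → Tm 𝒜) :
    (M.subst fun x => Nat.casesOn x (var 0) fun y => (σ y).rename Nat.succ).inst V =
      M.subst (scons V σ) := by
  rw [inst, subst_subst]
  congr 1
  funext x
  cases x with
  | zero => rfl
  | succ x => exact (subst_rename (σ x) _ _).trans (subst_var (σ x))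

namespace Steps

theorem map {f : Tm 𝒜 → Tm 𝒜} (hf : ∀ {M N}, Step M N → Step (f M) (f N)) {M N : Tm 𝒜}
    (h : Steps M N) : Steps (f M) (f N) :=
  Relation.ReflTransGen.lift f (fun _ _ => hf) _ _ h

theorem app {M M' N N' : Tm 𝒜} (hM : Steps M M') (hN : Steps N N') :
    Steps (M.app N) (M'.app N') :=
  Relation.ReflTransGen.trans (hM.map (Step.appL N)) (hN.map (Step.appR M'))

theorem beta_subst (M : Tm 𝒜) (σ : ℕ → Tm 𝒜) {V : Tm 𝒜} (hV : V.IsValue) :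
    Steps ((M.lam.subst σ).app V) (M.subst (scons V σ)) :=
  Relation.ReflTransGen.single (.contract (subst_inst M V σ ▸ .beta _ V hV))

end Steps

/-! ### Binary strings and binary trees as terms -/

/-- The constructor of `B` that prepends a bit to a string. -/
def bit (b : Bool) : Tm 𝒜 := bif b then con .B (1 : Fin 3) else con .B (0 : Fin 3)

theorem ofString_cons (b : Bool) (s : List Bool) :
    (ofString (b :: s) : Tm 𝒜) = (bit b).app (ofString s) := by
  cases b <;> rfl

theorem isAlgebraic_bit (b : Bool) : (bit b : Tm 𝒜).IsAlgebraic := by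
  cases b <;> exact .con _ _

theorem isAlgebraic_ofString : ∀ s, (ofString s : Tm 𝒜).IsAlgebraic
  | [] => .con _ _
  | b :: s => ofString_cons (𝒜 := 𝒜) b s ▸ .app (isAlgebraic_bit b) (isAlgebraic_ofString s)

theorem isFree_ofString : ∀ s, IsFree .B (ofString s : Tm 𝒜)
  | [] => .mk (a := .B) (2 : Fin 3) ![] fun j => Fin.elim0 (show Fin 0 from j)
  | false :: s => .mk (a := .B) (0 : Fin 3) ![ofString s] fun (0 : Fin 1) => isFree_ofString s
  | true :: s => .mk (a := .B) (1 : Fin 3) ![ofString s] fun (0 : Fin 1) => isFree_ofString s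

end Tm

/-- Binary trees, the elements of the free algebra `C`. -/
inductive BinTree : Type
  | leaf
  | node (a b : BinTree)

namespace BinTree

/-- The term of the algebra `C` for a binary tree. -/
def toTm : BinTree → Tm 𝒜
  | leaf => .con .C (1 : Fin 2)
  | node a b => (Tm.app (.con .C (0 : Fin 2)) a.toTm).app b.toTm

theorem isAlgebraic_toTm : ∀ t : BinTree, (t.toTm : Tm 𝒜).IsAlgebraic
  | leaf => .con _ _
  | node a b => .app (.app (.con _ _) a.isAlgebraic_toTm) b.isAlgebraic_toTm

theorem isFree_toTm : ∀ t : BinTree, Tm.IsFree .C (t.toTm : Tm 𝒜)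
  | leaf => .mk (a := .C) (1 : Fin 2) ![] fun j => Fin.elim0 (show Fin 0 from j)
  | node a b => .mk (a := .C) (0 : Fin 2) ![a.toTm, b.toTm] fun j =>
      match (show Fin 2 from j) with
      | 0 => a.isFree_toTm
      | 1 => b.isFree_toTm

end BinTree

/-! ### Realizability -/

/-- The interpretation of a free algebra as a type. Only `B` and `C` get their intended meaning:
the other algebras play no role in the simulation of machines. -/
def Idx.Sem : Idx 𝒜 → Type
  | .B => List Bool
  | .C => BinTree
  | _ => Unit

/-- The interpretation of a type as a full function space over the algebras. -/
@[reducible] def Ty.Sem : Ty 𝒜 → Type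
  | .base a _ => a.Sem
  | .arrow A B => A.Sem → B.Sem

instance Idx.instInhabitedSem : ∀ a : Idx 𝒜, Inhabited a.Sem
  | .B => ⟨[]⟩
  | .C => ⟨BinTree.leaf⟩
  | .U | .D | .other _ => ⟨()⟩

instance Ty.instInhabitedSem : ∀ A : Ty 𝒜, Inhabited A.Sem
  | .base a _ => a.instInhabitedSem
  | .arrow _ B => ⟨fun _ => B.instInhabitedSem.default⟩

/-- `V.Codes a d`: the term `V` is the element `d` of the free algebra `a`. -/
def Tm.Codes (V : Tm 𝒜) : (a : Idx 𝒜) → a.Sem → Prop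
  | .B, s => V = .ofString s
  | .C, t => V = BinTree.toTm t
  | _, _ => False

/-- The logical relation between values and elements of the interpretation of their type. -/
def IsRealizer : (A : Ty 𝒜) → Tm 𝒜 → A.Sem → Prop
  | .base a _, V, d => V.Codes a d
  | .arrow A B, V, f => V.IsValue ∧ ∀ U u, IsRealizer A U u →
      ∃ W, (V.app U).Steps W ∧ IsRealizer B W (f u)

/-- `M` reduces to a realizer of `d`. -/
def Realizes (A : Ty 𝒜) (M : Tm 𝒜) (d : A.Sem) : Prop := ∃ V, M.Steps V ∧ IsRealizer A V d

theorem IsRealizer.isValue : ∀ {A : Ty 𝒜} {V : Tm 𝒜} {d : A.Sem}, IsRealizer A V d → V.IsValue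
  | .base .B _, _, s, h => .alg (h ▸ Tm.isAlgebraic_ofString s)
  | .base .C _, _, t, h => .alg (h ▸ BinTree.isAlgebraic_toTm t)
  | .arrow _ _, _, _, h => h.1

theorem IsRealizer.realizes {A : Ty 𝒜} {V : Tm 𝒜} {d : A.Sem} (h : IsRealizer A V d) :
    Realizes A V d :=
  ⟨V, .refl, h⟩

theorem Realizes.of_steps {A : Ty 𝒜} {M N : Tm 𝒜} {d : A.Sem} (hMN : M.Steps N)
    (h : Realizes A N d) : Realizes A M d :=
  let ⟨V, hV, hd⟩ := h
  ⟨V, hMN.trans hV, hd⟩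

theorem Realizes.app {A B : Ty 𝒜} {M N : Tm 𝒜} {f : (A ⊸ B).Sem} {d : A.Sem}
    (hM : Realizes (A ⊸ B) M f) (hN : Realizes A N d) : Realizes B (M.app N) (f d) := by
  obtain ⟨V, hMV, -, hf⟩ := hM
  obtain ⟨U, hNU, hd⟩ := hN
  exact .of_steps (hMV.app hNU) (hf U d hd)

theorem IsRealizer.lam {A B : Ty 𝒜} {M : Tm 𝒜} {σ : ℕ → Tm 𝒜} {f : (A ⊸ B).Sem}
    (h : ∀ U u, IsRealizer A U u → Realizes B (M.subst (Tm.scons U σ)) (f u)) :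
    IsRealizer (A ⊸ B) (M.lam.subst σ) f :=
  ⟨.lam _, fun U u hU => Realizes.of_steps (Tm.Steps.beta_subst M σ hU.isValue) (h U u hU)⟩

theorem isRealizer_bit (m : ℕ) (b : Bool) :
    IsRealizer (.base .B m ⊸ .base .B m) (Tm.bit b : Tm 𝒜) (List.cons b) := by
  refine ⟨.alg (Tm.isAlgebraic_bit b), ?_⟩
  rintro _ s rfl
  exact ⟨_, .refl, (Tm.ofString_cons b s).symm⟩

theorem isRealizer_node (j : ℕ) :
    IsRealizer (.base .C j ⊸ .base .C j ⊸ .base .C j) (.con .C (0 : Fin 2) : Tm 𝒜)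
      BinTree.node := by
  refine ⟨.alg (.con _ _), ?_⟩
  rintro _ a rfl
  refine ⟨_, .refl, .alg (.app (.con _ _) a.isAlgebraic_toTm), ?_⟩
  rintro _ b rfl
  exact ⟨_, .refl, rfl⟩

/-! ### Derivations that compute their typing context -/

/-- Typing contexts, as lists indexed by the variables, where each declared variable comes with an
element of the interpretation of its type. -/
abbrev Env (𝒜 : Family) : Type := List (Option (Σ A : Ty 𝒜, A.Sem))

namespace Ctx

/-- The typing context of the variables that are declared in `l` but not in `l'`. -/
def sdiff (l l' : Env 𝒜) : Ctx 𝒜 :=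
  fun x => if (l'.getD x none).isSome then none else (l.getD x none).map Sigma.fst

theorem sdiff_self (l : Env 𝒜) : sdiff l l = empty := by
  funext x
  unfold sdiff empty
  cases l.getD x none <;> rfl

theorem isDisjointUnion_sdiff {l l₁ l₂ : Env 𝒜}
    (h₁ : ∀ x P, l₁.getD x none = some P → l.getD x none = some P)
    (h₂ : ∀ x P, l₂.getD x none = some P → l₁.getD x none = some P) :
    IsDisjointUnion ![sdiff l l₁, sdiff l₁ l₂] (sdiff l l₂) := by
  constructor
  · intro x i j hi hj
    fin_cases i <;> fin_cases j <;> simp_all [sdiff]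
  · intro x A
    have h₁ := h₁ x
    have h₂ := h₂ x
    simp only [sdiff, Fin.exists_fin_two, Matrix.cons_val_zero, Matrix.cons_val_one]
    generalize l.getD x none = a at *
    generalize l₁.getD x none = b at *
    generalize l₂.getD x none = c at *
    cases a <;> cases b <;> cases c <;> simp_all

theorem isDisjointUnion_option (κ : Type) (Δ : Ctx 𝒜) :
    IsDisjointUnion (fun o : Option κ => o.elim Δ fun _ => empty) Δ := by
  constructor
  · intro x i j hi hj
    cases i <;> cases j <;> simp_all [empty]
  · intro x A
    simp [Option.exists, empty]

end Ctx

variable {𝒟 : Set (Ty 𝒜)}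

/-- `Computes 𝒟 l M A d l'`: in the variables that are declared in `l` but no more in `l'`, the
term `M` has type `A`, and its interpretation is `d` when the variables in `l` stand for the
elements that come with them. Threading `l` through a linear term, with the used variables
replaced by `none`, takes care of the side conditions on contexts in the typing rules. -/
structure Computes (𝒟 : Set (Ty 𝒜)) (l : Env 𝒜) (M : Tm 𝒜) (A : Ty 𝒜)
    (d : A.Sem) (l' : Env 𝒜) : Prop where
  sub : ∀ x P, l'.getD x none = some P → l.getD x none = some P
  typed : RH 𝒟 (Ctx.sdiff l l') M A
  realizes : ∀ σ, (∀ x P, l.getD x none = some P → IsRealizer P.1 (σ x) P.2) →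
    Realizes A (M.subst σ) d

/-- `M` is a term of type `A` in the empty context with interpretation `d`. -/
structure Denotes (𝒟 : Set (Ty 𝒜)) (M : Tm 𝒜) (A : Ty 𝒜) (d : A.Sem) : Prop where
  typed : RH 𝒟 .empty M A
  realizes : ∀ σ, Realizes A (M.subst σ) d

/-- The elements of the interpretation of `A` that are denoted by some term. -/
def Definable (𝒟 : Set (Ty 𝒜)) (A : Ty 𝒜) (d : A.Sem) : Prop := ∃ M, Denotes 𝒟 M A d

namespace Computes

theorem denotes {M : Tm 𝒜} {A : Ty 𝒜} {d : A.Sem} (h : Computes 𝒟 [] M A d []) :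
    Denotes 𝒟 M A d :=
  ⟨Ctx.sdiff_self [] ▸ h.typed, fun σ => h.realizes σ fun x P hx => by simp at hx⟩

theorem definable {M : Tm 𝒜} {A : Ty 𝒜} {d : A.Sem} (h : Computes 𝒟 [] M A d []) :
    Definable 𝒟 A d :=
  ⟨M, h.denotes⟩

theorem closed {l : Env 𝒜} {M : Tm 𝒜} {A : Ty 𝒜} {d : A.Sem}
    (h : Denotes 𝒟 M A d) : Computes 𝒟 l M A d l :=
  ⟨fun _ _ h => h, Ctx.sdiff_self l ▸ h.typed, fun σ _ => h.realizes σ⟩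

theorem var {l : Env 𝒜} (x : ℕ) {A : Ty 𝒜} {d : A.Sem}
    (h : l.getD x none = some ⟨A, d⟩) : Computes 𝒟 l (.var x) A d (l.set x none) := by
  have hset : ∀ y, (l.set x none).getD y none = if y = x then none else l.getD y none := by
    intro y
    by_cases hy : y = x
    · rw [hy, List.getD, List.getElem?_set_self', if_pos rfl]
      cases l[x]? <;> rfl
    · simp [List.getD, hy, Ne.symm hy]
  refine ⟨fun y P hy => ?_, ?_, fun σ hσ => (hσ x _ h).realizes⟩
  · rw [hset] at hy
    split_ifs at hy
    exact hy
  · convert RH.ax x A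
    funext y
    rw [Ctx.sdiff, Ctx.extend, hset]
    by_cases hy : y = x
    · rw [if_pos hy, if_pos hy, hy, h]
      rfl
    · rw [if_neg hy, if_neg hy]
      cases l.getD y none <;> rfl

theorem app {l l₁ l₂ : Env 𝒜} {M N : Tm 𝒜} {A B : Ty 𝒜}
    {f : (A ⊸ B).Sem} {d : A.Sem} (hM : Computes 𝒟 l M (A ⊸ B) f l₁)
    (hN : Computes 𝒟 l₁ N A d l₂) : Computes 𝒟 l (.app M N) B (f d) l₂ :=
  ⟨fun x P h => hM.sub x P (hN.sub x P h),
    .app (Ctx.isDisjointUnion_sdiff hM.sub hN.sub) hM.typed hN.typed,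
    fun σ hσ => (hM.realizes σ hσ).app (hN.realizes σ fun x P h => hσ x P (hM.sub x P h))⟩

theorem lam {l l' : Env 𝒜} {M : Tm 𝒜} {A B : Ty 𝒜}
    {f : (A ⊸ B).Sem} {o : A.Sem → Option (Σ A : Ty 𝒜, A.Sem)}
    (h : ∀ x, Computes 𝒟 (some ⟨A, x⟩ :: l) M B (f x) (o x :: l')) :
    Computes 𝒟 l (.lam M) (A ⊸ B) f l' := by
  refine ⟨fun x P hx => (h default).sub (x + 1) P (by simpa using hx), .lam ?_, fun σ hσ =>
    (IsRealizer.lam fun U u hU => (h u).realizes _ ?_).realizes⟩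
  · have hbind (o) : Ctx.bind A (Ctx.sdiff l l') =
        (Ctx.sdiff (some ⟨A, default⟩ :: l) (o :: l')).extend 0 A := by
      funext x
      cases x <;> rfl
    have ht := (h default).typed
    cases ho : o default with
    | none =>
      rw [ho] at ht
      convert ht
      funext x
      cases x <;> rfl
    | some P =>
      rw [ho] at ht
      exact hbind _ ▸ .weak 0 A rfl ht
  · rintro (_ | x) P hx
    · obtain rfl : ⟨A, u⟩ = P := by simpa using hx
      exact hU
    · exact hσ x P (by simpa using hx)

end Computes

/-! ### Definable functions -/

theorem RH.lam_recur {a : Idx 𝒜} {m : ℕ} {R : Ty 𝒜} (hm : R.level < m)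
    {M : Fin a.alg.numCon → Tm 𝒜}
    (hM : ∀ i, RH 𝒟 .empty (M i)
      (.arrows (.base a m) (a.alg.arity i) (.arrows R (a.alg.arity i) R))) :
    RH 𝒟 .empty (.lam (.recur (.var 0) a.alg.numCon M)) (.base a m ⊸ R) := by
  refine .lam (.recur a m (Γs := fun _ => .empty) (Ctx.isDisjointUnion_option _ _)
    (fun _ _ _ h => by cases h) hm hM ?_)
  convert RH.ax 0 (.base a m)
  funext x
  cases x <;> rfl

theorem RH.lam_cond {a : Idx 𝒜} {m : ℕ} {R : Ty 𝒜} {M : Fin a.alg.numCon → Tm 𝒜}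
    (hM : ∀ i, RH 𝒟 .empty (M i) (.arrows (.base a m) (a.alg.arity i) R)) :
    RH 𝒟 .empty (.lam (.cond (.var 0) a.alg.numCon M)) (.base a m ⊸ R) := by
  refine .lam (.cond a m (Γs := fun _ => .empty) (Ctx.isDisjointUnion_option _ _) hM ?_)
  convert RH.ax 0 (.base a m)
  funext x
  cases x <;> rfl

theorem Realizes.recur_ofString {R : Ty 𝒜} {m : ℕ} {f : List Bool → R.Sem}
    {g : Bool → List Bool → R.Sem → R.Sem} {M : Fin 3 → Tm 𝒜}
    (h₀ : Realizes (.base .B m ⊸ R ⊸ R) (M 0) (g false))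
    (h₁ : Realizes (.base .B m ⊸ R ⊸ R) (M 1) (g true)) (h₂ : Realizes R (M 2) (f []))
    (hcons : ∀ b s, f (b :: s) = g b s (f s)) :
    ∀ s, Realizes R (.recur (.ofString s) 3 M) (f s)
  | [] => .of_steps (.single (.contract (.recur .B (2 : Fin 3) ![]
      (fun j => Fin.elim0 (show Fin 0 from j)) M))) h₂
  | b :: s => by
    have hs : Realizes (.base .B m) (Tm.ofString s : Tm 𝒜) s := IsRealizer.realizes rfl
    have ih := recur_ofString h₀ h₁ h₂ hcons s
    rw [hcons]
    cases b
    · exact .of_steps (.single (.contract (.recur .B (0 : Fin 3) ![.ofString s]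
        (fun (0 : Fin 1) => Tm.isFree_ofString s) M))) ((h₀.app hs).app ih)
    · exact .of_steps (.single (.contract (.recur .B (1 : Fin 3) ![.ofString s]
        (fun (0 : Fin 1) => Tm.isFree_ofString s) M))) ((h₁.app hs).app ih)

theorem BinTree.isFree_children (a b : BinTree) :
    ∀ j : Fin 2, Tm.IsFree .C ((![a.toTm, b.toTm] : Fin 2 → Tm 𝒜) j)
  | 0 => a.isFree_toTm
  | 1 => b.isFree_toTm

theorem Realizes.recur_toTm {R : Ty 𝒜} {m : ℕ} {f : BinTree → R.Sem}
    {g : BinTree → BinTree → R.Sem → R.Sem → R.Sem} {M : Fin 2 → Tm 𝒜}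
    (h₀ : Realizes (.base .C m ⊸ .base .C m ⊸ R ⊸ R ⊸ R) (M 0) g)
    (h₁ : Realizes R (M 1) (f .leaf))
    (hnode : ∀ a b, f (.node a b) = g a b (f a) (f b)) :
    ∀ t : BinTree, Realizes R (.recur t.toTm 2 M) (f t)
  | .leaf => .of_steps (.single (.contract (.recur .C (1 : Fin 2) ![]
      (fun j => Fin.elim0 (show Fin 0 from j)) M))) h₁
  | .node a b => by
    have ha : Realizes (.base .C m) (a.toTm : Tm 𝒜) a := IsRealizer.realizes rfl
    have hb : Realizes (.base .C m) (b.toTm : Tm 𝒜) b := IsRealizer.realizes rfl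
    rw [hnode]
    exact .of_steps (.single (.contract (.recur .C (0 : Fin 2) ![a.toTm, b.toTm]
      (a.isFree_children b) M))) ((((h₀.app ha).app hb).app (recur_toTm h₀ h₁ hnode a)).app
        (recur_toTm h₀ h₁ hnode b))

theorem Realizes.cond_toTm {R : Ty 𝒜} {m : ℕ} {f : BinTree → R.Sem}
    {g : BinTree → BinTree → R.Sem} {M : Fin 2 → Tm 𝒜}
    (h₀ : Realizes (.base .C m ⊸ .base .C m ⊸ R) (M 0) g) (h₁ : Realizes R (M 1) (f .leaf))
    (hnode : ∀ a b, f (.node a b) = g a b) :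
    ∀ t : BinTree, Realizes R (.cond t.toTm 2 M) (f t)
  | .leaf => .of_steps (.single (.contract (.cond .C (1 : Fin 2) ![]
      (fun j => Fin.elim0 (show Fin 0 from j)) M))) h₁
  | .node a b => by
    have ha : Realizes (.base .C m) (a.toTm : Tm 𝒜) a := IsRealizer.realizes rfl
    have hb : Realizes (.base .C m) (b.toTm : Tm 𝒜) b := IsRealizer.realizes rfl
    rw [hnode]
    exact .of_steps (.single (.contract (.cond .C (0 : Fin 2) ![a.toTm, b.toTm]
      (a.isFree_children b) M))) ((h₀.app ha).app hb)

namespace Definable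

theorem app {A B : Ty 𝒜} {f : (A ⊸ B).Sem} {d : A.Sem} (hf : Definable 𝒟 (A ⊸ B) f)
    (hd : Definable 𝒟 A d) : Definable 𝒟 B (f d) := by
  obtain ⟨F, hF⟩ := hf
  obtain ⟨M, hM⟩ := hd
  exact (Computes.app (.closed hF) (.closed hM)).definable

protected theorem id (A : Ty 𝒜) : Definable 𝒟 (A ⊸ A) id :=
  (Computes.lam fun _ => .var 0 rfl).definable

theorem const (A : Ty 𝒜) {B : Ty 𝒜} {d : B.Sem} (hd : Definable 𝒟 B d) :
    Definable 𝒟 (A ⊸ B) fun _ => d := by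
  obtain ⟨M, hM⟩ := hd
  exact (Computes.lam fun _ => .closed hM).definable

theorem comp {A B C : Ty 𝒜} {f : B.Sem → C.Sem} {g : A.Sem → B.Sem}
    (hf : Definable 𝒟 (B ⊸ C) f) (hg : Definable 𝒟 (A ⊸ B) g) : Definable 𝒟 (A ⊸ C) (f ∘ g) := by
  obtain ⟨F, hF⟩ := hf
  obtain ⟨G, hG⟩ := hg
  exact (Computes.lam fun _ => .app (.closed hF) (.app (.closed hG) (.var 0 rfl))).definable

theorem iterate {A : Ty 𝒜} {f : A.Sem → A.Sem} (hf : Definable 𝒟 (A ⊸ A) f) :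
    ∀ n, Definable 𝒟 (A ⊸ A) f^[n]
  | 0 => .id A
  | n + 1 => (hf.iterate n).comp hf

theorem contract {A B : Ty 𝒜} (hA : A ∈ 𝒟) {f : A.Sem → A.Sem → B.Sem}
    (hf : Definable 𝒟 (A ⊸ A ⊸ B) f) : Definable 𝒟 (A ⊸ B) fun x => f x x := by
  obtain ⟨F, hF⟩ := hf
  have hbody : ∀ x y : A.Sem, Computes 𝒟 [some ⟨A, x⟩, some ⟨A, y⟩]
      ((F.app (.var 0)).app (.var 1)) B (f x y) [none, none] := fun x y =>
    .app (.app (.closed hF) (.var 0 rfl)) (.var 1 rfl)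
  refine ⟨.lam (((F.app (.var 0)).app (.var 1)).rename fun v => if v = 0 ∨ v = 1 then 0 else v),
    .lam ?_, fun σ => (IsRealizer.lam fun U u hU => ?_).realizes⟩
  · convert RH.contr (Γ := .empty) 0 1 0 A hA zero_ne_one rfl rfl rfl ?_
    · funext x
      cases x <;> rfl
    · convert (hbody default default).typed
      funext x
      obtain _ | _ | x := x <;> rfl
  · rw [Tm.subst_rename]
    refine (hbody u u).realizes _ ?_
    rintro (_ | _ | x) P hx
    · obtain rfl : ⟨A, u⟩ = P := by simpa using hx
      exact hU
    · obtain rfl : ⟨A, u⟩ = P := by simpa using hx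
      exact hU
    · simp at hx

theorem cons (m : ℕ) (b : Bool) : Definable 𝒟 (.base .B m ⊸ .base .B m) (List.cons b) := by
  refine ⟨.bit b, ?_, fun σ => ?_⟩
  · cases b
    exacts [.con .B (0 : Fin 3) m, .con .B (1 : Fin 3) m]
  · convert (isRealizer_bit m b).realizes
    cases b <;> rfl

theorem nil (m : ℕ) : Definable 𝒟 (.base .B m) [] :=
  ⟨.ofString [], .con .B (2 : Fin 3) m, fun _ => IsRealizer.realizes rfl⟩

theorem node (j : ℕ) : Definable 𝒟 (.base .C j ⊸ .base .C j ⊸ .base .C j) BinTree.node :=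
  ⟨.con .C (0 : Fin 2), .con .C (0 : Fin 2) j, fun _ => (isRealizer_node j).realizes⟩

theorem tree (j : ℕ) : ∀ t : BinTree, Definable 𝒟 (.base .C j) t
  | .leaf => ⟨.con .C (1 : Fin 2), .con .C (1 : Fin 2) j, fun _ => IsRealizer.realizes rfl⟩
  | .node a b => ((node j).app (tree j a)).app (tree j b)

theorem strRec {R : Ty 𝒜} {m : ℕ} (hm : R.level < m) {f : List Bool → R.Sem}
    {g : Bool → List Bool → R.Sem → R.Sem} (hnil : Definable 𝒟 R (f []))
    (hg : ∀ b, Definable 𝒟 (.base .B m ⊸ R ⊸ R) (g b))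
    (hcons : ∀ b s, f (b :: s) = g b s (f s)) : Definable 𝒟 (.base .B m ⊸ R) f := by
  obtain ⟨N, hN⟩ := hnil
  obtain ⟨G₀, hG₀⟩ := hg false
  obtain ⟨G₁, hG₁⟩ := hg true
  refine ⟨.lam (.recur (.var 0) 3 ![G₀, G₁, N]), RH.lam_recur (a := .B) hm ?_, fun σ =>
    (IsRealizer.lam ?_).realizes⟩
  · intro i
    change Fin 3 at i
    fin_cases i
    exacts [hG₀.typed, hG₁.typed, hN.typed]
  · rintro _ s rfl
    exact .recur_ofString (hG₀.realizes _) (hG₁.realizes _) (hN.realizes _) hcons s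

theorem treeRec {R : Ty 𝒜} {m : ℕ} (hm : R.level < m) {f : BinTree → R.Sem}
    {g : BinTree → BinTree → R.Sem → R.Sem → R.Sem} (hleaf : Definable 𝒟 R (f .leaf))
    (hg : Definable 𝒟 (.base .C m ⊸ .base .C m ⊸ R ⊸ R ⊸ R) g)
    (hnode : ∀ a b, f (.node a b) = g a b (f a) (f b)) : Definable 𝒟 (.base .C m ⊸ R) f := by
  obtain ⟨N, hN⟩ := hleaf
  obtain ⟨G, hG⟩ := hg
  refine ⟨.lam (.recur (.var 0) 2 ![G, N]), RH.lam_recur (a := .C) hm ?_, fun σ =>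
    (IsRealizer.lam ?_).realizes⟩
  · intro i
    change Fin 2 at i
    fin_cases i
    exacts [hG.typed, hN.typed]
  · rintro _ t rfl
    exact .recur_toTm (hG.realizes _) (hN.realizes _) hnode t

theorem treeCases {R : Ty 𝒜} {m : ℕ} {f : BinTree → R.Sem} {g : BinTree → BinTree → R.Sem}
    (hleaf : Definable 𝒟 R (f .leaf)) (hg : Definable 𝒟 (.base .C m ⊸ .base .C m ⊸ R) g)
    (hnode : ∀ a b, f (.node a b) = g a b) : Definable 𝒟 (.base .C m ⊸ R) f := by
  obtain ⟨N, hN⟩ := hleaf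
  obtain ⟨G, hG⟩ := hg
  refine ⟨.lam (.cond (.var 0) 2 ![G, N]), RH.lam_cond (a := .C) ?_, fun σ =>
    (IsRealizer.lam ?_).realizes⟩
  · intro i
    change Fin 2 at i
    fin_cases i
    exacts [hG.typed, hN.typed]
  · rintro _ t rfl
    exact .cond_toTm (hG.realizes _) (hN.realizes _) hnode t

theorem exists_represents {m n : ℕ} {f : List Bool → List Bool}
    (hf : Definable 𝒟 (.base .B m ⊸ .base .B n) f) :
    ∃ M : Tm 𝒜, RH 𝒟 .empty M (.base .B m ⊸ .base .B n) ∧ M.Represents f := by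
  obtain ⟨M, hM⟩ := hf
  refine ⟨M, hM.typed, fun s => ?_⟩
  have hs : Realizes (.base .B m) (Tm.ofString s : Tm 𝒜) s := IsRealizer.realizes rfl
  obtain ⟨V, hV, hd⟩ := (hM.realizes .var).app hs
  rw [Tm.subst_var] at hV
  obtain rfl : V = .ofString (f s) := hd
  exact hV

/-- The diagonal of a function of two strings is definable at a higher tier even where contraction
is not available: the recursion builds both copies of the argument in parallel. -/
theorem diag {R : Ty 𝒜} {m : ℕ} (hR : R.level ≤ m) {K : List Bool → List Bool → R.Sem}
    (hK : Definable 𝒟 (.base .B m ⊸ .base .B m ⊸ R) K) :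
    Definable 𝒟 (.base .B (m + 1) ⊸ R) fun s => K s s := by
  have hnil : Definable 𝒟 ((.base .B m ⊸ .base .B m ⊸ R) ⊸ R) fun K => K [] [] := by
    obtain ⟨N, hN⟩ := nil (𝒟 := 𝒟) m
    exact (Computes.lam fun _ =>
      .app (.app (.var 0 rfl) (.closed hN)) (.closed hN)).definable
  have hcons : ∀ b, Definable 𝒟 (.base .B (m + 1) ⊸ ((.base .B m ⊸ .base .B m ⊸ R) ⊸ R) ⊸
      (.base .B m ⊸ .base .B m ⊸ R) ⊸ R) fun _ r K => r fun s t => K (b :: s) (b :: t) := by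
    intro b
    obtain ⟨N, hN⟩ := cons (𝒟 := 𝒟) m b
    exact (Computes.lam fun _ => .lam fun _ => .lam fun _ => .app (.var 1 rfl) (.lam fun _ =>
      .lam fun _ => .app (.app (.var 2 rfl) (.app (.closed hN) (.var 1 rfl)))
        (.app (.closed hN) (.var 0 rfl)))).definable
  have hdiag : Definable 𝒟 (.base .B (m + 1) ⊸ (.base .B m ⊸ .base .B m ⊸ R) ⊸ R)
      fun s K => K s s :=
    strRec (by simp only [Ty.level]; omega) hnil hcons fun _ _ => rfl
  obtain ⟨D, hD⟩ := hdiag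
  obtain ⟨F, hF⟩ := hK
  exact (Computes.lam fun _ => .app (.app (.closed hD) (.var 0 rfl)) (.closed hF)).definable

end Definable

/-! ### Clocks -/

/-- A clock with values `N n` on the type `A`: iteration for `N n` rounds of a definable function on
`A` is definable, with an input string of length `n` and tier `m` as counter. -/
def IsClock (𝒟 : Set (Ty 𝒜)) (A : Ty 𝒜) (m : ℕ) (N : ℕ → ℕ) : Prop :=
  ∀ f : A.Sem → A.Sem, Definable 𝒟 (A ⊸ A) f →
    Definable 𝒟 (.base .B m ⊸ A ⊸ A) fun s : List Bool => f^[N s.length]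

namespace IsClock

variable {A : Ty 𝒜} {m : ℕ} {N : ℕ → ℕ}

theorem one (A : Ty 𝒜) (m : ℕ) : IsClock 𝒟 A m fun _ => 1 := fun _ hf => hf.const _

theorem const_mul (c : ℕ) (hN : IsClock 𝒟 A m N) : IsClock 𝒟 A m fun n => c * N n := by
  intro f hf
  simp only [Function.iterate_mul]
  exact hN _ (hf.iterate c)

theorem sum (hm : A.level < m) (hN : IsClock 𝒟 A m N) :
    IsClock 𝒟 A m fun n => ∑ i ∈ Finset.range (n + 1), N i := by
  intro f hf
  obtain ⟨I, hI⟩ := hN f hf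
  have hnil : Definable 𝒟 (A ⊸ A) f^[∑ i ∈ Finset.range 1, N i] := by
    rw [Finset.sum_range_one]
    exact (hN f hf).app (.nil m)
  have hcons : ∀ b, Definable 𝒟 (.base .B m ⊸ (A ⊸ A) ⊸ A ⊸ A)
      fun (s : List Bool) r x => f^[N (b :: s).length] (r x) := by
    intro b
    obtain ⟨C, hC⟩ := Definable.cons (𝒟 := 𝒟) m b
    exact (Computes.lam fun _ => .lam fun _ => .lam fun _ =>
      .app (.app (.closed hI) (.app (.closed hC) (.var 2 rfl)))
        (.app (.var 1 rfl) (.var 0 rfl))).definable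
  refine .strRec (by simpa [Ty.level]) hnil hcons fun b s => ?_
  simp only [List.length_cons]
  rw [Finset.sum_range_succ _ (s.length + 1), add_comm, Function.iterate_add]
  rfl

theorem choose (hm : A.level < m) : ∀ k, IsClock 𝒟 A m fun n => (n + k).choose k
  | 0 => by simpa only [Nat.choose_zero_right] using one A m
  | k + 1 => by
    simpa only [Nat.sum_range_add_choose, add_assoc] using (choose hm k).sum hm

end IsClock

theorem pow_le_factorial_mul_choose (n k : ℕ) :
    (n + 1) ^ k ≤ k.factorial * (n + k).choose k := by
  rw [← Nat.ascFactorial_eq_factorial_mul_choose]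
  exact Nat.pow_succ_le_ascFactorial (n + 1) k

theorem polynomial_eval_le_mul_choose (p : Polynomial ℕ) (n : ℕ) :
    p.eval n ≤
      p.eval 1 * p.natDegree.factorial * (n + p.natDegree).choose p.natDegree := by
  calc p.eval n
      ≤ p.eval 1 * (n + 1) ^ p.natDegree := by
        rw [Polynomial.eval_eq_sum_range, Polynomial.eval_eq_sum_range, Finset.sum_mul]
        refine Finset.sum_le_sum fun i hi => ?_
        rw [one_pow, mul_one]
        refine Nat.mul_le_mul_left _ ?_
        calc n ^ i ≤ (n + 1) ^ i := Nat.pow_le_pow_left n.le_succ i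
          _ ≤ (n + 1) ^ p.natDegree :=
            Nat.pow_le_pow_right n.succ_pos (Finset.mem_range_succ_iff.1 hi)
    _ ≤ p.eval 1 * (p.natDegree.factorial * (n + p.natDegree).choose p.natDegree) := by
        gcongr
        exact pow_le_factorial_mul_choose n _
    _ = _ := (mul_assoc _ _ _).symm

theorem IsClock.exists_polynomial_eval_le {A : Ty 𝒜} {m : ℕ} (hm : A.level < m)
    (p : Polynomial ℕ) : ∃ N, IsClock 𝒟 A m N ∧ ∀ n, p.eval n ≤ N n :=
  ⟨_, (IsClock.choose hm p.natDegree).const_mul (p.eval 1 * p.natDegree.factorial),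
    polynomial_eval_le_mul_choose p⟩

namespace BinTree

/-- The complete binary tree of a given height. -/
def full : ℕ → BinTree
  | 0 => leaf
  | n + 1 => node (full n) (full n)

/-- The number of leaves of a tree. -/
def numLeaves : BinTree → ℕ
  | leaf => 1
  | node a b => a.numLeaves + b.numLeaves

theorem numLeaves_full (n : ℕ) : (full n).numLeaves = 2 ^ n := by
  induction n with
  | zero => rfl
  | succ n ih => rw [full, numLeaves, ih, pow_succ, mul_two]

end BinTree

theorem Definable.full_length {j m : ℕ} (hj : .base .C j ∈ 𝒟) (hjm : j < m) :
    Definable 𝒟 (.base .B m ⊸ .base .C j) fun s : List Bool => BinTree.full s.length :=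
  .strRec hjm (.tree j .leaf) (fun _ => (Definable.contract hj (.node j)).const _) fun _ _ => rfl

theorem Definable.iterate_numLeaves {A : Ty 𝒜} {j : ℕ} (hj : A.level < j) {f : A.Sem → A.Sem}
    (hf : Definable 𝒟 (A ⊸ A) f) :
    Definable 𝒟 (.base .C j ⊸ A ⊸ A) fun t : BinTree => f^[t.numLeaves] := by
  have hnode : Definable 𝒟 (.base .C j ⊸ .base .C j ⊸ (A ⊸ A) ⊸ (A ⊸ A) ⊸ A ⊸ A)
      fun _ _ r₁ r₂ x => r₁ (r₂ x) :=
    (Computes.lam fun _ => .lam fun _ => .lam fun _ => .lam fun _ => .lam fun _ =>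
      .app (.var 2 rfl) (.app (.var 1 rfl) (.var 0 rfl))).definable
  exact .treeRec (by simpa [Ty.level]) hf hnode
    fun a b => Function.iterate_add _ a.numLeaves b.numLeaves

theorem length_iterate_cons {α : Type*} (a : α) (n : ℕ) : ((List.cons a)^[n] []).length = n := by
  induction n with
  | zero => rfl
  | succ n ih => rw [Function.iterate_succ_apply', List.length_cons, ih]

theorem IsClock.comp_two_pow {A : Ty 𝒜} {m : ℕ} {N : ℕ → ℕ} (hm : .base .C (m + 1) ∈ 𝒟)
    (hN : IsClock 𝒟 A m N) : IsClock 𝒟 A (m + 2) fun n => N (2 ^ n) := by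
  intro f hf
  have hpow : Definable 𝒟 (.base .B (m + 2) ⊸ .base .B m ⊸ .base .B m)
      fun s : List Bool => (List.cons true)^[(BinTree.full s.length).numLeaves] :=
    (Definable.iterate_numLeaves m.lt_succ_self (.cons m true)).comp
      (.full_length hm (m + 1).lt_succ_self)
  obtain ⟨E, hE⟩ := hpow
  obtain ⟨F, hF⟩ := hN f hf
  obtain ⟨O, hO⟩ := Definable.nil (𝒟 := 𝒟) m
  have hclock : Definable 𝒟 (.base .B (m + 2) ⊸ A ⊸ A) fun s : List Bool =>
      f^[N ((List.cons true)^[(BinTree.full s.length).numLeaves] []).length] :=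
    (Computes.lam fun _ => .app (.closed hF)
      (.app (.app (.closed hE) (.var 0 rfl)) (.closed hO))).definable
  simpa only [length_iterate_cons, BinTree.numLeaves_full] using hclock

/-! ### Elementary bounds -/

/-- The tower of `k` twos with top exponent `n`. -/
def tower (k n : ℕ) : ℕ := (fun x => 2 ^ x)^[k] n

theorem tower_succ (k n : ℕ) : tower (k + 1) n = 2 ^ tower k n :=
  Function.iterate_succ_apply' _ _ _

theorem tower_add (j k n : ℕ) : tower (j + k) n = tower j (tower k n) :=
  Function.iterate_add_apply _ _ _ _

theorem tower_mono_left {j k : ℕ} (h : j ≤ k) (n : ℕ) : tower j n ≤ tower k n :=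
  monotone_nat_of_le_succ (f := fun k => tower k n)
    (fun k => by rw [tower_succ]; exact Nat.lt_two_pow_self.le) h

theorem le_tower (k n : ℕ) : n ≤ tower k n := tower_mono_left k.zero_le n

theorem two_mul_le_two_pow (n : ℕ) : 2 * n ≤ 2 ^ n := by
  cases n with
  | zero => exact Nat.zero_le _
  | succ n =>
    rw [pow_succ']
    exact Nat.mul_le_mul_left _ Nat.lt_two_pow_self

theorem mul_self_le_tower (n : ℕ) : n * n ≤ tower 2 n :=
  calc n * n ≤ 2 ^ n * 2 ^ n := Nat.mul_le_mul Nat.lt_two_pow_self.le Nat.lt_two_pow_self.le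
    _ = 2 ^ (2 * n) := by rw [two_mul, pow_add]
    _ ≤ tower 2 n := Nat.pow_le_pow_right two_pos (two_mul_le_two_pow n)

theorem pow_self_le_tower (n : ℕ) : n ^ n ≤ tower 3 n :=
  calc n ^ n ≤ (2 ^ n) ^ n := Nat.pow_le_pow_left Nat.lt_two_pow_self.le n
    _ = 2 ^ (n * n) := (pow_mul _ _ _).symm
    _ ≤ tower 3 n := by
      rw [tower_succ]
      exact Nat.pow_le_pow_right two_pos (mul_self_le_tower n)

/-- The tower of some fixed height over an upper bound of the arguments bounds the value of `f`. -/
def IsTowerBounded {n : ℕ} (f : (Fin n → ℕ) → ℕ) : Prop :=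
  ∃ k, ∀ v x, (∀ i, v i ≤ x) → f v ≤ tower k x

namespace IsTowerBounded

theorem comp {m n : ℕ} {f : (Fin m → ℕ) → ℕ} {g : Fin m → (Fin n → ℕ) → ℕ}
    (hf : IsTowerBounded f) (hg : ∀ i, IsTowerBounded (g i)) :
    IsTowerBounded fun v => f fun i => g i v := by
  obtain ⟨k, hk⟩ := hf
  choose j hj using hg
  refine ⟨k + Finset.univ.sup j, fun v x hx => ?_⟩
  rw [tower_add]
  exact hk _ _ fun i => (hj i v x hx).trans
    (tower_mono_left (Finset.le_sup (Finset.mem_univ i)) x)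

theorem exists_bound_of_mem_range {n : ℕ} {f : (Fin (n + 1) → ℕ) → ℕ} (hf : IsTowerBounded f) :
    ∃ k, ∀ v x, (∀ i, v i ≤ x) → ∀ i ∈ Finset.range (v 0),
      f (Fin.cons i (Fin.tail v)) ≤ tower k x := by
  obtain ⟨k, hk⟩ := hf
  exact ⟨k, fun v x hx i hi => hk _ _
    (Fin.cases ((Finset.mem_range.1 hi).le.trans (hx 0)) fun j => hx j.succ)⟩

theorem bsum {n : ℕ} {f : (Fin (n + 1) → ℕ) → ℕ} (hf : IsTowerBounded f) :
    IsTowerBounded fun v : Fin (n + 1) → ℕ =>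
      ∑ i ∈ Finset.range (v 0), f (Fin.cons i (Fin.tail v)) := by
  obtain ⟨k, hk⟩ := hf.exists_bound_of_mem_range
  refine ⟨2 + k, fun v x hx => ?_⟩
  calc ∑ i ∈ Finset.range (v 0), f (Fin.cons i (Fin.tail v))
      ≤ (Finset.range (v 0)).card • tower k x := Finset.sum_le_card_nsmul _ _ _ (hk v x hx)
    _ = v 0 * tower k x := by rw [Finset.card_range, smul_eq_mul]
    _ ≤ tower k x * tower k x := Nat.mul_le_mul_right _ ((hx 0).trans (le_tower k x))
    _ ≤ tower (2 + k) x := by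
      rw [tower_add]
      exact mul_self_le_tower _

theorem bprod {n : ℕ} {f : (Fin (n + 1) → ℕ) → ℕ} (hf : IsTowerBounded f) :
    IsTowerBounded fun v : Fin (n + 1) → ℕ =>
      ∏ i ∈ Finset.range (v 0), f (Fin.cons i (Fin.tail v)) := by
  obtain ⟨k, hk⟩ := hf.exists_bound_of_mem_range
  refine ⟨3 + (k + 1), fun v x hx => ?_⟩
  have hpos : 0 < tower (k + 1) x := by rw [tower_succ]; positivity
  calc ∏ i ∈ Finset.range (v 0), f (Fin.cons i (Fin.tail v))
      ≤ tower (k + 1) x ^ (Finset.range (v 0)).card := Finset.prod_le_pow_card _ _ _ fun i hi =>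
        (hk v x hx i hi).trans (tower_mono_left k.le_succ x)
    _ = tower (k + 1) x ^ v 0 := by rw [Finset.card_range]
    _ ≤ tower (k + 1) x ^ tower (k + 1) x :=
      Nat.pow_le_pow_right hpos ((hx 0).trans (le_tower _ x))
    _ ≤ tower (3 + (k + 1)) x := by
      rw [tower_add 3]
      exact pow_self_le_tower _

end IsTowerBounded

theorem Elementary.isTowerBounded {n : ℕ} {f : (Fin n → ℕ) → ℕ} (hf : Elementary f) :
    IsTowerBounded f := by
  induction hf with
  | zero => exact ⟨0, fun _ _ _ => Nat.zero_le _⟩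
  | succ => exact ⟨1, fun v x hx => (Nat.succ_le_succ (hx 0)).trans Nat.lt_two_pow_self⟩
  | proj i => exact ⟨0, fun v x hx => hx i⟩
  | add =>
    refine ⟨1, fun v x hx => ?_⟩
    calc v 0 + v 1 ≤ 2 * x := by linarith [hx 0, hx 1]
      _ ≤ 2 ^ x := two_mul_le_two_pow x
  | tsub => exact ⟨0, fun v x hx => (Nat.sub_le _ _).trans (hx 0)⟩
  | comp _ _ ihf ihg => exact ihf.comp ihg
  | bsum _ ih => exact ih.bsum
  | bprod _ ih => exact ih.bprod

theorem IsClock.exists_tower {A : Ty 𝒜} (h𝒟 : ∀ j, .base .C j ∈ 𝒟) :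
    ∀ k, ∃ m, A.level < m ∧ IsClock 𝒟 A m fun n => tower k n + 1
  | 0 => ⟨A.level + 1, A.level.lt_succ_self, by
    simpa [tower] using (IsClock.one A _).sum A.level.lt_succ_self⟩
  | k + 1 => by
    obtain ⟨m, hm, hN⟩ := exists_tower (A := A) h𝒟 k
    refine ⟨m + 2, by omega, ?_⟩
    simpa only [tower, Function.iterate_succ_apply] using hN.comp_two_pow (h𝒟 _)

/-! ### Recodings of trees -/

namespace BinTree

/-- A list of trees as one tree, with the members of the list to the left of a spine. -/
def ofList (l : List BinTree) : BinTree := l.foldr node leaf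

/-- The numeral `n`, which serves as a label: a spine with `n` nodes. -/
def num (n : ℕ) : BinTree := ofList (List.replicate n leaf)

/-- The length of the rightmost branch, which inverts `num`. -/
def spine : BinTree → ℕ
  | leaf => 0
  | node _ b => b.spine + 1

theorem spine_num : ∀ n, (num n).spine = n
  | 0 => rfl
  | n + 1 => congrArg (· + 1) (spine_num n)

/-- The string whose `i`-th letter is the value of `p` at the label of the `i`-th member of a list
of trees. -/
def readString (p : ℕ → Bool) : BinTree → List Bool
  | leaf => []
  | node a b => p a.spine :: b.readString p

theorem readString_ofList {p : ℕ → Bool} {e : Bool → ℕ} (hp : ∀ b, p (e b) = b) :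
    ∀ s : List Bool, (ofList (s.map fun b => num (e b))).readString p = s
  | [] => rfl
  | b :: s => congrArg₂ _ ((congrArg p (spine_num (e b))).trans (hp b)) (readString_ofList hp s)

end BinTree

open BinTree

theorem Definable.labelCases {R : Ty 𝒜} {g : ℕ → R.Sem} (j N : ℕ)
    (hg : ∀ i, Definable 𝒟 R (g i)) :
    Definable 𝒟 (.base .C j ⊸ R) fun t => g (min t.spine N) := by
  induction N generalizing g with
  | zero => simpa only [Nat.min_zero] using Definable.const _ (hg 0)
  | succ N ih =>
    obtain ⟨F, hF⟩ := ih fun i => hg (i + 1)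
    have hsucc : Definable 𝒟 (.base .C j ⊸ .base .C j ⊸ R)
        fun _ t => g (min t.spine N + 1) :=
      (Computes.lam fun _ => .lam fun _ => .app (.closed hF) (.var 0 rfl)).definable
    exact .treeCases (hg 0) hsucc fun _ t => congrArg g (Nat.succ_min_succ t.spine N)

theorem Definable.readString {p : ℕ → Bool} {j N : ℕ} (hj : 0 < j) :
    Definable 𝒟 (.base .C j ⊸ .base .B 0) (BinTree.readString fun i => p (min i N)) := by
  obtain ⟨H, hH⟩ := Definable.labelCases (𝒟 := 𝒟) (R := .base .B 0 ⊸ .base .B 0) j N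
    fun i => .cons 0 (p i)
  have hnode : Definable 𝒟 (.base .C j ⊸ .base .C j ⊸ .base .B 0 ⊸ .base .B 0 ⊸ .base .B 0)
      fun a _ _ s => p (min a.spine N) :: s :=
    (Computes.lam fun _ => .lam fun _ => .lam fun _ => .lam fun _ =>
      .app (.app (.closed hH) (.var 3 rfl)) (.var 0 rfl)).definable
  exact .treeRec hj (.nil 0) hnode fun _ _ => rfl

theorem Definable.exists_readString {j : ℕ} (hj : 0 < j) {e : Bool → ℕ}
    (he : Function.Injective e) : ∃ f, Definable 𝒟 (.base .C j ⊸ .base .B 0) f ∧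
      ∀ s : List Bool, f (ofList (s.map fun b => num (e b))) = s := by
  set N := max (e false) (e true)
  have hp : ∀ b, decide (min (e b) N = e true) = b := by
    intro b
    have hle : e b ≤ N := by
      cases b
      exacts [le_max_left _ _, le_max_right _ _]
    simp only [min_eq_left hle, he.eq_iff, Bool.decide_eq_true]
  exact ⟨_, .readString (p := fun n => decide (n = e true)) hj, fun s =>
    readString_ofList (p := fun n => decide (min n N = e true)) hp s⟩

theorem Definable.nodeCases {j : ℕ} {g : BinTree → BinTree → BinTree}
    (hg : Definable 𝒟 (.base .C j ⊸ .base .C j ⊸ .base .C j) g) :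
    ∃ f, Definable 𝒟 (.base .C j ⊸ .base .C j) f ∧
      ∀ a b, f (.node a b) = g a b :=
  ⟨fun t => t.casesOn leaf g, .treeCases (.tree j leaf) hg fun _ _ => rfl, fun _ _ => rfl⟩

/-- Some definable function on trees of tier `j` sends the code `φ x` of each `x ∈ s` to the
code `ψ x`. -/
def Recodes (𝒟 : Set (Ty 𝒜)) (j : ℕ) {α : Type*} (s : Set α) (φ ψ : α → BinTree) : Prop :=
  ∃ f, Definable 𝒟 (.base .C j ⊸ .base .C j) f ∧ Set.EqOn (f ∘ φ) ψ s

namespace Recodes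

variable {j : ℕ} {α β : Type*} {s : Set α} {φ ψ χ : α → BinTree}

protected theorem refl (s : Set α) (φ : α → BinTree) : Recodes 𝒟 j s φ φ :=
  ⟨id, .id _, fun _ _ => rfl⟩

theorem trans (h₁ : Recodes 𝒟 j s φ ψ) (h₂ : Recodes 𝒟 j s ψ χ) : Recodes 𝒟 j s φ χ := by
  obtain ⟨f, hf, hfs⟩ := h₁
  obtain ⟨g, hg, hgs⟩ := h₂
  exact ⟨g ∘ f, hg.comp hf, fun x hx => (congrArg g (hfs hx)).trans (hgs hx)⟩

theorem congr {ψ' : α → BinTree} (h : Recodes 𝒟 j s φ ψ) (hψ : Set.EqOn ψ ψ' s) :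
    Recodes 𝒟 j s φ ψ' := by
  obtain ⟨f, hf, hfs⟩ := h
  exact ⟨f, hf, hfs.trans hψ⟩

theorem comp_mapsTo {t : Set β} {φ ψ : β → BinTree} (h : Recodes 𝒟 j t φ ψ) {g : α → β}
    (hg : Set.MapsTo g s t) : Recodes 𝒟 j s (φ ∘ g) (ψ ∘ g) := by
  obtain ⟨f, hf, hft⟩ := h
  exact ⟨f, hf, fun x hx => hft (hg hx)⟩

theorem node_left (t : BinTree) : Recodes 𝒟 j s φ fun x => node t (φ x) :=
  ⟨node t, (Definable.node j).app (.tree j t), fun _ _ => rfl⟩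

theorem node_right (h : Recodes 𝒟 j s φ ψ) (χ : α → BinTree) :
    Recodes 𝒟 j s (fun x => node (χ x) (φ x)) fun x => node (χ x) (ψ x) := by
  obtain ⟨f, ⟨F, hF⟩, hfs⟩ := h
  obtain ⟨N, hN⟩ := Definable.node (𝒟 := 𝒟) j
  have hg : Definable 𝒟 (.base .C j ⊸ .base .C j ⊸ .base .C j) fun a b => node a (f b) :=
    (Computes.lam fun _ => .lam fun _ =>
      .app (.app (.closed hN) (.var 1 rfl)) (.app (.closed hF) (.var 0 rfl))).definable
  obtain ⟨g, hg, hgnode⟩ := hg.nodeCases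
  exact ⟨g, hg, fun x hx => (hgnode _ _).trans (congrArg (node (χ x)) (hfs hx))⟩

end Recodes

namespace Definable

theorem node_swap (j : ℕ) : ∃ f, Definable 𝒟 (.base .C j ⊸ .base .C j) f ∧
    ∀ a b c, f (.node a (.node b c)) = .node b (.node a c) := by
  obtain ⟨N, hN⟩ := node (𝒟 := 𝒟) j
  have hinner : Definable 𝒟 (.base .C j ⊸ .base .C j ⊸ .base .C j ⊸ .base .C j)
      fun b c a => .node b (.node a c) :=
    (Computes.lam fun _ => .lam fun _ => .lam fun _ => .app (.app (.closed hN) (.var 2 rfl))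
      (.app (.app (.closed hN) (.var 0 rfl)) (.var 1 rfl))).definable
  obtain ⟨F, hF⟩ : Definable 𝒟 (.base .C j ⊸ .base .C j ⊸ .base .C j)
      fun t => t.casesOn (fun _ => .leaf) fun b c a => .node b (.node a c) :=
    .treeCases (.const _ (.tree j .leaf)) hinner fun _ _ => rfl
  have houter : Definable 𝒟 (.base .C j ⊸ .base .C j ⊸ .base .C j)
      fun a t => t.casesOn .leaf fun b c => .node b (.node a c) := by
    convert (Computes.lam fun _ => .lam fun _ =>
      .app (.app (.closed hF) (.var 0 rfl)) (.var 1 rfl)).definable with a t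
    cases t <;> rfl
  obtain ⟨f, hf, hfnode⟩ := houter.nodeCases
  exact ⟨f, hf, fun _ _ _ => hfnode _ _⟩

theorem cons_left {j : ℕ} (t : BinTree) : ∃ f, Definable 𝒟 (.base .C j ⊸ .base .C j) f ∧
    ∀ a b, f (.node a b) = .node (.node t a) b := by
  obtain ⟨N, hN⟩ := node (𝒟 := 𝒟) j
  obtain ⟨T, hT⟩ := tree (𝒟 := 𝒟) j t
  have : Definable 𝒟 (.base .C j ⊸ .base .C j ⊸ .base .C j) fun a b => .node (.node t a) b :=
    (Computes.lam fun _ => .lam fun _ => .app (.app (.closed hN)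
      (.app (.app (.closed hN) (.closed hT)) (.var 1 rfl))) (.var 0 rfl)).definable
  exact this.nodeCases

theorem label_head (j : ℕ) : ∃ f, Definable 𝒟 (.base .C j ⊸ .base .C j) f ∧
    (∀ r, f (.node (ofList []) r) = .node (num 0) (.node (ofList []) r)) ∧
    ∀ i l r, f (.node (ofList (num i :: l)) r) = .node (num (i + 1)) (.node (ofList l) r) := by
  obtain ⟨N, hN⟩ := node (𝒟 := 𝒟) j
  obtain ⟨L, hL⟩ := tree (𝒟 := 𝒟) j .leaf
  have hnil : Definable 𝒟 (.base .C j ⊸ .base .C j) fun r => .node .leaf (.node .leaf r) :=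
    ((node j).app (tree j _)).comp ((node j).app (tree j _))
  have hcons : Definable 𝒟 (.base .C j ⊸ .base .C j ⊸ .base .C j ⊸ .base .C j)
      fun a b r => .node (.node .leaf a) (.node b r) :=
    (Computes.lam fun _ => .lam fun _ => .lam fun _ => .app
      (.app (.closed hN) (.app (.app (.closed hN) (.closed hL)) (.var 2 rfl)))
      (.app (.app (.closed hN) (.var 1 rfl)) (.var 0 rfl))).definable
  have : Definable 𝒟 (.base .C j ⊸ .base .C j ⊸ .base .C j) fun t =>
      t.casesOn (fun r => .node .leaf (.node .leaf r))
        fun a b r => .node (.node .leaf a) (.node b r) :=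
    .treeCases hnil hcons fun _ _ => rfl
  obtain ⟨f, hf, hfnode⟩ := this.nodeCases
  exact ⟨f, hf, fun _ => hfnode _ _, fun _ _ _ => hfnode _ _⟩

end Definable

namespace Recodes

theorem perm {j : ℕ} {K : Type*} {ks ks' : List K} (h : ks.Perm ks') :
    Recodes 𝒟 j Set.univ (fun φ : K → BinTree => ofList (ks.map φ))
      fun φ => ofList (ks'.map φ) := by
  induction h with
  | nil => exact .refl _ _
  | cons k _ ih => exact ih.node_right fun φ => φ k
  | swap k l _ =>
    obtain ⟨f, hf, hfnode⟩ := Definable.node_swap (𝒟 := 𝒟) j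
    exact ⟨f, hf, fun _ _ => hfnode _ _ _⟩
  | trans _ _ ih₁ ih₂ => exact ih₁.trans ih₂

theorem of_label {j : ℕ} {α β : Type*} {s : Set α} {φ ψ : α → BinTree} {B : Set β}
    (hB : B.Finite) {e : β → ℕ} (he : Set.InjOn e B) {lab : α → β} (hlab : Set.MapsTo lab s B)
    (h : ∀ b, Recodes 𝒟 j {x ∈ s | lab x = b} φ ψ) :
    Recodes 𝒟 j s (fun x => node (num (e (lab x))) (φ x)) ψ := by
  have hcode : ∀ i, ∃ f, Definable 𝒟 (.base .C j ⊸ .base .C j) f ∧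
      ∀ b ∈ B, e b = i → Set.EqOn (f ∘ φ) ψ {x ∈ s | lab x = b} := by
    intro i
    by_cases hi : ∃ b ∈ B, e b = i
    · obtain ⟨b, hb, rfl⟩ := hi
      obtain ⟨f, hf, hfb⟩ := h b
      exact ⟨f, hf, fun b' hb' hbb' => he hb' hb hbb' ▸ hfb⟩
    · exact ⟨id, .id _, fun b hb hbi => absurd ⟨b, hb, hbi⟩ hi⟩
  choose g hg hgs using hcode
  obtain ⟨N, hN⟩ := (hB.image e).bddAbove
  obtain ⟨f, hf, hfnode⟩ := (Definable.labelCases j N hg).nodeCases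
  refine ⟨f, hf, fun x hx => ?_⟩
  have hle : e (lab x) ≤ N := hN ⟨lab x, hlab hx, rfl⟩
  have hdispatch : f (node (num (e (lab x))) (φ x)) = g (e (lab x)) (φ x) := by
    rw [hfnode, spine_num, min_eq_left hle]
  exact hdispatch.trans (hgs _ _ (hlab hx) rfl ⟨hx, rfl⟩)

end Recodes

/-! ### Simulation of stack machines -/

section Machine

open Turing Turing.TM2

variable {K : Type} {Γ : K → Type} {Λ σ : Type}

/-- The symbols, tagged with their stack, that a statement can push. -/
def pushes : Stmt Γ Λ σ → Set (Σ k, Γ k)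
  | .push k f q => Set.range (fun v => ⟨k, f v⟩) ∪ pushes q
  | .peek _ _ q => pushes q
  | .pop _ _ q => pushes q
  | .load _ q => pushes q
  | .branch _ q₁ q₂ => pushes q₁ ∪ pushes q₂
  | .goto _ => ∅
  | .halt => ∅

theorem finite_pushes [Finite σ] (q : Stmt Γ Λ σ) : (pushes q).Finite := by
  induction q with
  | push k f q ih => exact (Set.finite_range _).union ih
  | peek _ _ _ ih => exact ih
  | pop _ _ _ ih => exact ih
  | load _ _ ih => exact ih
  | branch _ _ _ ih₁ ih₂ => exact ih₁.union ih₂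
  | goto _ => exact Set.finite_empty
  | halt => exact Set.finite_empty

/-- The families of stacks all of whose symbols belong to the alphabet `A`. A stack machine may
have infinite stack alphabets, but its runs only meet finitely many symbols. -/
def stacksOver (A : Set (Σ k, Γ k)) : Set (∀ k, List (Γ k)) :=
  {S | ∀ k, ∀ γ ∈ S k, ⟨k, γ⟩ ∈ A}

/-- The code of a family of stacks, given a list `ks` of stack names and a labelling `e` of the
symbols. -/
def stacksTree (e : (Σ k, Γ k) → ℕ) (ks : List K) (S : ∀ k, List (Γ k)) : BinTree :=
  ofList (ks.map fun k => ofList ((S k).map fun γ => num (e ⟨k, γ⟩)))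

/-- The code of a configuration, given moreover a labelling `ε` of the control states. -/
def cfgTree (e : (Σ k, Γ k) → ℕ) (ks : List K) (ε : Option Λ × σ → ℕ) (c : Cfg Γ Λ σ) :
    BinTree :=
  node (num (ε (c.l, c.var))) (stacksTree e ks c.stk)

section Stacks

variable [DecidableEq K] {A : Set (Σ k, Γ k)} {S : ∀ k, List (Γ k)}

theorem update_mem_stacksOver (hS : S ∈ stacksOver A) {k : K} {l : List (Γ k)}
    (hl : ∀ γ ∈ l, ⟨k, γ⟩ ∈ A) : Function.update S k l ∈ stacksOver A := by
  intro k'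
  obtain rfl | hk := eq_or_ne k' k
  · rwa [Function.update_self]
  · rw [Function.update_of_ne hk]
    exact hS k'

theorem pop_mem_stacksOver (hS : S ∈ stacksOver A) (k : K) :
    Function.update S k (S k).tail ∈ stacksOver A :=
  update_mem_stacksOver hS fun γ hγ => hS k γ (List.mem_of_mem_tail hγ)

theorem push_mem_stacksOver (hS : S ∈ stacksOver A) {k : K} {γ : Γ k} (hγ : ⟨k, γ⟩ ∈ A) :
    Function.update S k (γ :: S k) ∈ stacksOver A :=
  update_mem_stacksOver hS (List.forall_mem_cons.2 ⟨hγ, hS k⟩)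

theorem stepAux_stk_mem_stacksOver {q : Stmt Γ Λ σ} (hq : pushes q ⊆ A) (v : σ)
    (hS : S ∈ stacksOver A) : (stepAux q v S).stk ∈ stacksOver A := by
  induction q generalizing v S with
  | push k g q ih =>
    exact ih (fun x hx => hq (.inr hx)) v (push_mem_stacksOver hS (hq (.inl ⟨v, rfl⟩)))
  | peek k g q ih => exact ih hq _ hS
  | pop k g q ih => exact ih hq _ (pop_mem_stacksOver hS k)
  | load g q ih => exact ih hq _ hS
  | branch p q₁ q₂ ih₁ ih₂ =>
    cases h : p v
    · simpa only [stepAux, h, cond_false] using ih₂ (fun x hx => hq (.inr hx)) v hS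
    · simpa only [stepAux, h, cond_true] using ih₁ (fun x hx => hq (.inl hx)) v hS
  | goto g => exact hS
  | halt => exact hS

theorem update_tail_eq_self {k : K} (h : (S k).head? = none) :
    Function.update S k (S k).tail = S := by
  rw [List.head?_eq_none_iff.1 h, List.tail_nil, ← List.head?_eq_none_iff.1 h,
    Function.update_eq_self]

theorem update_cons_update_tail {k : K} {γ : Γ k} (h : (S k).head? = some γ) :
    Function.update (Function.update S k (S k).tail) k
      (γ :: Function.update S k (S k).tail k) = S := by
  obtain ⟨l, hl⟩ := List.head?_eq_some_iff.1 h
  rw [Function.update_self, Function.update_idem, hl, List.tail_cons, ← hl,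
    Function.update_eq_self]

theorem stacksTree_cons_update (e : (Σ k, Γ k) → ℕ) {k : K} {ks : List K} (hk : k ∉ ks)
    (S : ∀ k, List (Γ k)) (l : List (Γ k)) :
    stacksTree e (k :: ks) (Function.update S k l) =
      node (ofList (l.map fun γ => num (e ⟨k, γ⟩))) (stacksTree e ks S) := by
  have hks : stacksTree e ks (Function.update S k l) = stacksTree e ks S :=
    congrArg ofList <| List.map_congr_left fun k' hk' => by
      rw [Function.update_of_ne (ne_of_mem_of_not_mem hk' hk)]
  exact congrArg₂ node (congrArg (fun l => ofList (l.map fun γ => num (e ⟨k, γ⟩)))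
    (Function.update_self k l S)) hks

end Stacks

namespace Recodes

variable {j : ℕ} {e : (Σ k, Γ k) → ℕ} {ks ks' : List K}

theorem stacksTree_perm (h : ks.Perm ks') (s : Set (∀ k, List (Γ k))) :
    Recodes 𝒟 j s (stacksTree e ks) (stacksTree e ks') :=
  (perm h).comp_mapsTo
    (g := fun (S : ∀ k, List (Γ k)) k => ofList ((S k).map fun γ => num (e ⟨k, γ⟩)))
    (Set.mapsTo_univ _ _)

variable [DecidableEq K] {k : K}

theorem push (hk : k ∈ ks) (hks : ks.Nodup) (γ : Γ k) (s : Set (∀ k, List (Γ k))) :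
    Recodes 𝒟 j s (stacksTree e ks)
      fun S => stacksTree e ks (Function.update S k (γ :: S k)) := by
  have hfront := List.perm_cons_erase hk
  have hpush : Recodes 𝒟 j s (stacksTree e (k :: ks.erase k))
      fun S => stacksTree e (k :: ks.erase k) (Function.update S k (γ :: S k)) := by
    obtain ⟨f, hf, hfnode⟩ := Definable.cons_left (𝒟 := 𝒟) (j := j) (num (e ⟨k, γ⟩))
    exact ⟨f, hf, fun S _ =>
      (hfnode _ _).trans (stacksTree_cons_update e hks.not_mem_erase S (γ :: S k)).symm⟩
  exact (stacksTree_perm hfront s).trans (hpush.trans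
    ((stacksTree_perm hfront.symm Set.univ).comp_mapsTo
      (g := fun S => Function.update S k (γ :: S k)) (Set.mapsTo_univ _ _)))

theorem label_top (hk : k ∈ ks) (hks : ks.Nodup) (s : Set (∀ k, List (Γ k))) :
    Recodes 𝒟 j s (stacksTree e ks) fun S =>
      node (num ((S k).head?.elim 0 fun γ => e ⟨k, γ⟩ + 1))
        (stacksTree e ks (Function.update S k (S k).tail)) := by
  have hfront := List.perm_cons_erase hk
  have hlabel : Recodes 𝒟 j s (stacksTree e (k :: ks.erase k))
      fun S => node (num ((S k).head?.elim 0 fun γ => e ⟨k, γ⟩ + 1))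
        (stacksTree e (k :: ks.erase k) (Function.update S k (S k).tail)) := by
    obtain ⟨f, hf, hfnil, hfcons⟩ := Definable.label_head (𝒟 := 𝒟) j
    refine ⟨f, hf, fun S _ => ?_⟩
    simp only [stacksTree_cons_update e hks.not_mem_erase]
    change f (node (ofList ((S k).map _)) (stacksTree e (ks.erase k) S)) = _
    cases S k with
    | nil => exact hfnil _
    | cons γ l => exact hfcons _ _ _
  exact (stacksTree_perm hfront s).trans (hlabel.trans (node_right
    ((stacksTree_perm hfront.symm Set.univ).comp_mapsTo
      (g := fun S => Function.update S k (S k).tail) (Set.mapsTo_univ _ _)) _))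

theorem of_head (hk : k ∈ ks) (hks : ks.Nodup) {A : Set (Σ k, Γ k)} (hA : A.Finite)
    (he : Set.InjOn e A) {ψ : (∀ k, List (Γ k)) → BinTree}
    (h : ∀ o, Recodes 𝒟 j {S ∈ stacksOver A | (S k).head? = o}
      (fun S => stacksTree e ks (Function.update S k (S k).tail)) ψ) :
    Recodes 𝒟 j (stacksOver A) (stacksTree e ks) ψ := by
  set B : Set (Option (Γ k)) := {o | ∀ γ ∈ o, ⟨k, γ⟩ ∈ A}
  have hB : B.Finite := by
    refine ((hA.preimage (sigma_mk_injective.injOn (s := _))).image some |>.insert none).subset ?_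
    rintro (_ | γ) ho
    exacts [.inl rfl, .inr ⟨γ, ho γ rfl, rfl⟩]
  refine (label_top hk hks _).trans (of_label (B := B)
    (lab := fun S : ∀ k, List (Γ k) => (S k).head?) (e := fun o => o.elim 0 fun γ => e ⟨k, γ⟩ + 1)
    hB ?_ (fun S hS γ hγ => hS k γ (List.mem_of_mem_head? hγ)) h)
  rintro (_ | γ) ho (_ | γ') ho' hoo
  · rfl
  · cases hoo
  · cases hoo
  · exact congrArg some (sigma_mk_injective (he (ho γ rfl) (ho' γ' rfl) (Nat.succ.inj hoo)))

end Recodes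

theorem Recodes.stepAux [DecidableEq K] {j : ℕ} {A : Set (Σ k, Γ k)} (hA : A.Finite)
    {e : (Σ k, Γ k) → ℕ} (he : Set.InjOn e A) {ks : List K} (hmem : ∀ k, k ∈ ks) (hks : ks.Nodup)
    (ε : Option Λ × σ → ℕ) {q : Stmt Γ Λ σ} (hq : pushes q ⊆ A) (v : σ) :
    Recodes 𝒟 j (stacksOver A) (stacksTree e ks) fun S => cfgTree e ks ε (stepAux q v S) := by
  induction q generalizing v with
  | push k g q ih =>
    exact (push (hmem k) hks (g v) _).trans ((ih (fun x hx => hq (.inr hx)) v).comp_mapsTo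
      fun S hS => push_mem_stacksOver hS (hq (.inl ⟨v, rfl⟩)))
  | peek k g q ih =>
    refine of_head (hmem k) hks hA he fun o => ?_
    have hrestore : Recodes 𝒟 j {S ∈ stacksOver A | (S k).head? = o}
        (fun S => stacksTree e ks (Function.update S k (S k).tail)) (stacksTree e ks) := by
      obtain _ | γ := o
      · exact (Recodes.refl _ _).congr fun S hS => congrArg _ (update_tail_eq_self hS.2)
      · exact ((push (hmem k) hks γ Set.univ).comp_mapsTo (Set.mapsTo_univ _ _)).congr
          fun S hS => congrArg (stacksTree e ks) (update_cons_update_tail hS.2)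
    refine hrestore.trans (((ih hq (g v o)).comp_mapsTo (g := id) fun S hS => hS.1).congr ?_)
    rintro S ⟨-, rfl⟩
    rfl
  | pop k g q ih =>
    refine of_head (hmem k) hks hA he fun o => (((ih hq (g v o)).comp_mapsTo
      (g := fun S => Function.update S k (S k).tail)
      fun S hS => pop_mem_stacksOver hS.1 k)).congr ?_
    rintro S ⟨-, rfl⟩
    rfl
  | load g q ih => exact ih hq (g v)
  | branch p q₁ q₂ ih₁ ih₂ =>
    cases h : p v
    · simpa only [TM2.stepAux, h, cond_false] using ih₂ (fun x hx => hq (.inr hx)) v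
    · simpa only [TM2.stepAux, h, cond_true] using ih₁ (fun x hx => hq (.inl hx)) v
  | goto g => exact .node_left (num (ε (some (g v), v)))
  | halt => exact .node_left (num (ε (none, v)))

theorem Recodes.exists_iterate {j : ℕ} {α : Type*} {s : Set α} {φ : α → BinTree} {g : α → α}
    (h : Recodes 𝒟 j s φ (φ ∘ g)) (hg : Set.MapsTo g s s) :
    ∃ f, Definable 𝒟 (.base .C j ⊸ .base .C j) f ∧ ∀ n, ∀ x ∈ s, f^[n] (φ x) = φ (g^[n] x) := by
  obtain ⟨f, hf, hfs⟩ := h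
  refine ⟨f, hf, fun n => ?_⟩
  induction n with
  | zero => exact fun _ _ => rfl
  | succ n ih => exact fun x hx => (congrArg f^[n] (hfs hx)).trans (ih _ (hg hx))

/-- The step function of a stack machine, made total by letting it fix the halting
configurations. -/
def totalStep [DecidableEq K] (M : Λ → Stmt Γ Λ σ) (c : Cfg Γ Λ σ) : Cfg Γ Λ σ :=
  (step M c).getD c

section TotalStep

variable [DecidableEq K] {M : Λ → Stmt Γ Λ σ}

theorem mapsTo_totalStep {A : Set (Σ k, Γ k)} (hM : ∀ l, pushes (M l) ⊆ A) :
    Set.MapsTo (totalStep M) {c | c.stk ∈ stacksOver A} {c | c.stk ∈ stacksOver A}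
  | ⟨none, _, _⟩, hc => hc
  | ⟨some l, v, _⟩, hc => stepAux_stk_mem_stacksOver (hM l) v hc

theorem Recodes.totalStep [Finite Λ] [Finite σ] {j : ℕ} {A : Set (Σ k, Γ k)} (hA : A.Finite)
    (hM : ∀ l, pushes (M l) ⊆ A) {e : (Σ k, Γ k) → ℕ} (he : Set.InjOn e A) {ks : List K}
    (hmem : ∀ k, k ∈ ks) (hks : ks.Nodup) {ε : Option Λ × σ → ℕ} (hε : Function.Injective ε) :
    Recodes 𝒟 j {c | c.stk ∈ stacksOver A} (cfgTree e ks ε)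
      (cfgTree e ks ε ∘ totalStep M) := by
  refine of_label (lab := fun c : Cfg Γ Λ σ => (c.l, c.var)) Set.finite_univ hε.injOn
    (Set.mapsTo_univ _ _) ?_
  rintro ⟨_ | l, v⟩
  · refine (node_left (num (ε (none, v)))).congr ?_
    rintro ⟨_, _, S⟩ ⟨-, ⟨⟩⟩
    rfl
  · refine ((Recodes.stepAux hA he hmem hks ε (hM l) v).comp_mapsTo (g := Cfg.stk)
      fun c hc => hc.1).congr ?_
    rintro ⟨_, _, S⟩ ⟨-, ⟨⟩⟩
    rfl

theorem iterate_totalStep_of_iterate_step {n : ℕ} {a b : Cfg Γ Λ σ}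
    (h : (flip bind (step M))^[n] (some a) = some b) : (totalStep M)^[n] a = b := by
  induction n generalizing a with
  | zero => exact Option.some.inj h
  | succ n ih =>
    rw [Function.iterate_succ_apply] at h ⊢
    change (flip bind (step M))^[n] (step M a) = some b at h
    cases ha : step M a with
    | none =>
      have hnone : flip bind (step M) (none : Option (Cfg Γ Λ σ)) = none := rfl
      rw [ha, Function.iterate_fixed hnone] at h
      cases h
    | some a' =>
      rw [ha] at h
      rw [totalStep, ha]
      exact ih h

theorem iterate_totalStep_of_halts {n m : ℕ} (hnm : n ≤ m) {a b : Cfg Γ Λ σ}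
    (h : (flip bind (step M))^[n] (some a) = some b) (hb : b.l = none) :
    (totalStep M)^[m] a = b := by
  have hfix : totalStep M b = b := by
    obtain ⟨_, v, S⟩ := b
    cases hb
    rfl
  obtain ⟨d, rfl⟩ := Nat.exists_eq_add_of_le' hnm
  rw [Function.iterate_add_apply, iterate_totalStep_of_iterate_step h,
    Function.iterate_fixed hfix]

end TotalStep

end Machine

section Run

open Turing

variable (tm : FinTM2) (i : Bool → tm.Γ tm.k₀) (o : Bool → tm.Γ tm.k₁)

/-- The symbols, tagged with their stack, that a machine with the letters of its input encoded
by `i` can meet, together with the codes under `o` of the letters of its output. -/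
def alphabet : Set (Σ k, tm.Γ k) :=
  (⋃ l, pushes (tm.m l)) ∪
    (Set.range (fun b => ⟨tm.k₀, i b⟩) ∪ Set.range fun b => ⟨tm.k₁, o b⟩)

theorem finite_alphabet : (alphabet tm i o).Finite := by
  have := tm.ΛFin
  have := tm.σFin
  exact (Set.finite_iUnion fun l => finite_pushes _).union
    ((Set.finite_range _).union (Set.finite_range _))

theorem initList_stk (l : List (tm.Γ tm.k₀)) :
    (initList tm l).stk = Function.update (fun _ => []) tm.k₀ l := by
  funext k
  obtain rfl | hk := eq_or_ne k tm.k₀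
  · simp [initList]
  · simp [initList, hk]

theorem haltList_stk_self (l : List (tm.Γ tm.k₁)) : (haltList tm l).stk tm.k₁ = l := by
  simp [haltList]

theorem initList_mem_stacksOver_alphabet (s : List Bool) :
    (initList tm (s.map i)).stk ∈ stacksOver (alphabet tm i o) := by
  rw [initList_stk]
  refine update_mem_stacksOver (fun _ _ h => absurd h List.not_mem_nil) fun γ hγ => ?_
  obtain ⟨b, -, rfl⟩ := List.mem_map.1 hγ
  exact .inr (.inl ⟨b, rfl⟩)

variable {tm i o} {e : (Σ k, tm.Γ k) → ℕ} {ks : List tm.K}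

theorem Definable.cfgTree_initList {j m : ℕ} (hjm : j < m) (hk : tm.k₀ ∈ ks) (hks : ks.Nodup)
    (ε : Option tm.Λ × tm.σ → ℕ) : Definable 𝒟 (.base .B m ⊸ .base .C j)
      fun s => cfgTree e ks ε (initList tm (s.map i)) := by
  have hcons : ∀ b, ∃ f, Definable 𝒟 (.base .C j ⊸ .base .C j) f ∧ ∀ s : List Bool,
      f (cfgTree e ks ε (initList tm (s.map i))) =
        cfgTree e ks ε (initList tm ((b :: s).map i)) := by
    intro b
    obtain ⟨f, hf, hfs⟩ := ((Recodes.push (𝒟 := 𝒟) (j := j) (e := e) hk hks (i b)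
      Set.univ).comp_mapsTo (g := fun s : List Bool => (initList tm (s.map i)).stk)
      (Set.mapsTo_univ _ _)).node_right fun _ => num (ε (some tm.main, tm.initialState))
    refine ⟨f, hf, fun s => (hfs (Set.mem_univ s)).trans ?_⟩
    simp only [cfgTree, initList_stk, Function.comp_apply, Function.update_self,
      Function.update_idem, List.map_cons]
    rfl
  choose f hf hfs using hcons
  have hconst : ∀ b, Definable 𝒟 (.base .B m ⊸ .base .C j ⊸ .base .C j) fun _ => f b :=
    fun b => .const _ (hf b)
  exact .strRec hjm (.tree j _) hconst fun b s => (hfs b s).symm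

theorem Definable.exists_output {j : ℕ} (hj : 0 < j) (hk : tm.k₁ ∈ ks)
    (he : Function.Injective fun b => e ⟨tm.k₁, o b⟩) (ε : Option tm.Λ × tm.σ → ℕ) :
    ∃ g, Definable 𝒟 (.base .C j ⊸ .base .B 0) g ∧ ∀ c : tm.Cfg, ∀ s : List Bool,
      c.stk tm.k₁ = s.map o → g (cfgTree e ks ε c) = s := by
  have hsnd : Definable 𝒟 (.base .C j ⊸ .base .C j ⊸ .base .C j) fun _ b => b :=
    .const _ (.id _)
  have hfst : Definable 𝒟 (.base .C j ⊸ .base .C j ⊸ .base .C j) fun a _ => a :=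
    (Computes.lam fun _ => .lam fun _ => .var 1 rfl).definable
  obtain ⟨right, hright, hright_node⟩ := hsnd.nodeCases
  obtain ⟨left, hleft, hleft_node⟩ := hfst.nodeCases
  obtain ⟨front, hfront, hfront_eq⟩ := Recodes.stacksTree_perm (𝒟 := 𝒟) (j := j) (e := e)
    (List.perm_cons_erase hk) Set.univ
  obtain ⟨read, hread, hread_ofList⟩ := Definable.exists_readString (𝒟 := 𝒟) hj he
  refine ⟨_, hread.comp (hleft.comp (hfront.comp hright)), fun c s hs => ?_⟩
  have hstack : left (front (right (cfgTree e ks ε c))) =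
      ofList ((c.stk tm.k₁).map fun γ => num (e ⟨tm.k₁, γ⟩)) :=
    (congrArg (left ∘ front) (hright_node _ _)).trans ((congrArg left
      (hfront_eq (Set.mem_univ c.stk))).trans (hleft_node _ _))
  rw [hs, List.map_map] at hstack
  exact (congrArg read hstack).trans (hread_ofList s)

theorem Definable.exists_simulation (tm : FinTM2) (i : Bool → tm.Γ tm.k₀)
    {o : Bool → tm.Γ tm.k₁} (ho : Function.Injective o) {j m : ℕ} (hj : 0 < j) (hjm : j < m) :
    ∃ (init : List Bool → BinTree) (step : BinTree → BinTree) (read : BinTree → List Bool),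
      Definable 𝒟 (.base .B m ⊸ .base .C j) init ∧ Definable 𝒟 (.base .C j ⊸ .base .C j) step ∧
      Definable 𝒟 (.base .C j ⊸ .base .B 0) read ∧ ∀ (s s' : List Bool) (n : ℕ),
        TM2OutputsInTime tm (s.map i) (some (s'.map o)) n →
          ∀ N, n ≤ N → read (step^[N] (init s)) = s' := by
  have := tm.kFin
  have := tm.ΛFin
  have := tm.σFin
  have hA := finite_alphabet tm i o
  obtain ⟨e, he⟩ := Set.countable_iff_exists_injOn.1 hA.countable
  obtain ⟨ε, hε⟩ := Countable.exists_injective_nat (Option tm.Λ × tm.σ)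
  let ks : List tm.K := Finset.univ.toList
  have hmem : ∀ k, k ∈ ks := fun k => Finset.mem_toList.2 (Finset.mem_univ k)
  have hks : ks.Nodup := Finset.nodup_toList _
  have hpushes : ∀ l, pushes (tm.m l) ⊆ alphabet tm i o :=
    fun l _ hx => .inl (Set.mem_iUnion.2 ⟨l, hx⟩)
  have he_out : Function.Injective fun b => e ⟨tm.k₁, o b⟩ := fun b b' hb =>
    ho (sigma_mk_injective (he (.inr (.inr ⟨b, rfl⟩)) (.inr (.inr ⟨b', rfl⟩)) hb))
  obtain ⟨step, hstep, hstep_iterate⟩ :=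
    (Recodes.totalStep (𝒟 := 𝒟) (j := j) hA hpushes he hmem hks hε).exists_iterate
      (mapsTo_totalStep hpushes)
  obtain ⟨read, hread, hread_eq⟩ := exists_output (𝒟 := 𝒟) hj (hmem tm.k₁) he_out ε
  refine ⟨_, step, read, cfgTree_initList (e := e) (i := i) hjm (hmem tm.k₀) hks ε, hstep, hread,
    fun s s' n hout N hN => ?_⟩
  have hhalt := iterate_totalStep_of_halts (hout.steps_le_m.trans hN) hout.evals_in_steps rfl
  refine (congrArg read (hstep_iterate N _ (initList_mem_stacksOver_alphabet tm i o s))).trans ?_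
  exact (congrArg (read ∘ cfgTree e ks ε) hhalt).trans (hread_eq _ _ (haltList_stk_self tm _))

theorem definable_of_computableInTime {f : List Bool → List Bool}
    (h : TM2ComputableInTime (id : List Bool → List Bool) id f) {m : ℕ} (hm : 1 < m) {N : ℕ → ℕ}
    (hN : IsClock 𝒟 (.base .C 1) m N) (hle : ∀ n, h.time n ≤ N n) :
    Definable 𝒟 (.base .B (m + 1) ⊸ .base .B 0) f := by
  obtain ⟨init, step, read, ⟨I, hI⟩, hstep, ⟨O, hO⟩, hread⟩ := Definable.exists_simulation (𝒟 := 𝒟)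
    h.tm h.inputAlphabet.invFun h.outputAlphabet.symm.injective one_pos hm
  obtain ⟨G, hG⟩ := hN step hstep
  have hrun : Definable 𝒟 (.base .B m ⊸ .base .B m ⊸ .base .B 0) fun s t =>
      read (step^[N s.length] (init t)) :=
    (Computes.lam fun _ => .lam fun _ => .app (.closed hO) (.app
      (.app (.closed hG) (.var 1 rfl)) (.app (.closed hI) (.var 0 rfl)))).definable
  have hf : f = fun s => read (step^[N s.length] (init s)) :=
    funext fun s => (hread s (f s) _ (h.outputsFun s) _ (hle _)).symm
  rw [hf]
  exact .diag (Nat.zero_le m) hrun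

end Run

theorem PolyTimeComputable.definable {f : List Bool → List Bool} (hf : PolyTimeComputable f) :
    Definable 𝒟 (.base .B 3 ⊸ .base .B 0) f := by
  obtain ⟨h⟩ := hf
  obtain ⟨N, hN, hle⟩ := IsClock.exists_polynomial_eval_le (𝒟 := 𝒟) (A := .base .C 1)
    (one_lt_two : 1 < 2) h.time
  exact definable_of_computableInTime h.toTM2ComputableInTime one_lt_two hN hle

theorem ElementaryTimeComputable.exists_definable (h𝒟 : ∀ j, .base .C j ∈ 𝒟)
    {f : List Bool → List Bool} (hf : ElementaryTimeComputable f) :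
    ∃ m, Definable 𝒟 (.base .B m ⊸ .base .B 0) f := by
  obtain ⟨h, htime⟩ := hf
  obtain ⟨k, hk⟩ := htime.isTowerBounded
  obtain ⟨m, hm, hN⟩ := IsClock.exists_tower (A := .base .C 1) h𝒟 k
  exact ⟨m + 1, definable_of_computableInTime h hm hN fun n =>
    (hk (fun _ => n) n fun _ => le_rfl).trans (Nat.le_succ _)⟩

end LinRec

theorem mainTheorem7 (𝒜 : LinRec.Family) :
    (∀ f : List Bool → List Bool, LinRec.PolyTimeComputable f →
      ∃ (M : LinRec.Tm 𝒜) (n : ℕ),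
        LinRec.RH ∅ LinRec.Ctx.empty M (.arrow (.base .B n) (.base .B 0)) ∧
        M.Represents f) ∧
    (∀ f : List Bool → List Bool, LinRec.ElementaryTimeComputable f →
      ∃ (M : LinRec.Tm 𝒜) (n : ℕ),
        LinRec.RH (LinRec.Ty.baseTypes 𝒜) LinRec.Ctx.empty M
          (.arrow (.base .B n) (.base .B 0)) ∧
        M.Represents f) := by
  refine ⟨fun f hf => ?_, fun f hf => ?_⟩
  · obtain ⟨M, hM, hMf⟩ := hf.definable.exists_represents
    exact ⟨M, 3, hM, hMf⟩
  · obtain ⟨m, hm⟩ := hf.exists_definable (𝒟 := LinRec.Ty.baseTypes 𝒜) fun j => ⟨.C, j, rfl⟩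
    obtain ⟨M, hM, hMf⟩ := hm.exists_represents
    exact ⟨M, m, hM, hMf⟩
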